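/- Let $n\ge 0$, and let $S_n$ be the symmetric group on $\{1,\dots,n\}$, acting on $\mathbb{Q}[x_1,\dots,x_n]$ by $\sigma x_i=x_{\sigma(i)}$. For $w\in S_n$ let $(P(w),Q(w))$ be the pair of standard Young tableaux (English notation) that the Robinson--Schensted--Knuth row insertion of the word $w(1)w(2)\cdots w(n)$ produces ($P$ the insertion tableau, $Q$ the recording tableau), and set $\tilde Q(w):=\operatorname{ev}Q(w)$, where $\operatorname{ev}$ is the Schützenberger evacuation: the upper left entry is repeatedly erased and a jeu de taquin slide is performed into its box, and the boxes vacated by the successive slides are labelled $n,n-1,\dots,1$. For a standard Young tableau $S$ with $n$ boxes let $\operatorname{Dsi}(S)$ be the set of $1\le i\le n-1$ such that $i+1$ lies in $S$ in a strictly lower row than $i$ and in a column that is weakly to the left of that of $i$, and let $\operatorname{ct}(S)$ be the tableau of the same shape in which each entry $p$ of $S$ is replaced by $|\{i\in\operatorname{Dsi}(S) : i<p\}|$. For a tableau $T$ of the same shape as $S$ with entries $1,\dots,n$, let $R(T)$ and $C(T)$ be the subgroups of $S_n$ preserving the rows and the columns of $T$ respectively, let $\varepsilon_T:=\sum_{\sigma\in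 C(T)}\sum_{\tau\in R(T)}\operatorname{sgn}(\sigma)\,\sigma\tau$, let $p_T^S:=\prod_{i=1}^n x_i^{h_i}$ where $h_i$ is the entry of $\operatorname{ct}(S)$ in the box containing $i$ in $T$, let $s_T^S$ be the size of the stabilizer of $p_T^S$ in $R(T)$, and set $F_T^S:=\varepsilon_T p_T^S/s_T^S$. For $w\in S_n$ put $F_w:=F_{P(w)}^{\tilde Q(w)}$. Let $w\in S_n$, and let $w_+\in S_{n+1}$ be the permutation that acts on $\{1,\dots,n\}$ as $w$ does and fixes $n+1$. Then, viewing $p_{P(w)}^{\tilde Q(w)}$ as a monomial in $\mathbb{Q}[x_1,\dots,x_{n+1}]$, $$F_{w_+}=\frac{1}{s_{P(w_+)}^{\tilde Q(w_+)}}\,\varepsilon_{P(w_+)}\,p_{P(w_+)}^{\tilde Q(w_+)}=\frac{1}{s_{P(w_+)}^{\tilde Q(w_+)}}\,\varepsilon_{P(w_+)}\,p_{P(w)}^{\tilde Q(w)} .$$ Moreover, substituting $x_{n+1}=0$ in $F_{w_+}$ yields $F_w$. -/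

import Mathlib

noncomputable section

namespace HigherSpecht

/-- A tableau as a filling of the boxes `(row, column)` (both counted from `0`) by natural
numbers, where the value `0` means that the box does not belong to the tableau.
The entries of a tableau of content `{1, …, n}` are thus its non-zero values. -/
abbrev Filling : Type := ℕ × ℕ → ℕ

/-! ### The Robinson-Schensted-Knuth algorithm -/

/-- The column at which `x` enters row `i` of `T` under row insertion: the leftmost box of
that row which is empty or has an entry larger than `x`. -/
def insertPos (T : Filling) (i x : ℕ) : ℕ :=
  sInf {j | T (i, j) = 0 ∨ x < T (i, j)}

/-- `bump T x i` is the number that is inserted into row `i` of `T` when `x` is row-inserted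
into `T`, with the value `0` if the insertion ended in an earlier row. -/
def bump (T : Filling) (x : ℕ) : ℕ → ℕ
  | 0 => x
  | i + 1 => if bump T x i = 0 then 0 else T (i, insertPos T i (bump T x i))

/-- Row insertion of the positive integer `x` into `T`. -/
def rowInsert (T : Filling) (x : ℕ) : Filling := fun c =>
  if bump T x c.1 ≠ 0 ∧ c.2 = insertPos T c.1 (bump T x c.1) then bump T x c.1 else T c

/-- The insertion tableau of the first `k` letters of the word `a 0, a 1, …`. -/
def insertionTableau (a : ℕ → ℕ) : ℕ → Filling
  | 0 => fun _ => 0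
  | k + 1 => rowInsert (insertionTableau a k) (a k)

/-- The recording tableau of the first `k` letters of the word `a 0, a 1, …`: the number
`k + 1` is put into the box by which the insertion tableau grew at step `k + 1`. -/
def recordingTableau (a : ℕ → ℕ) : ℕ → Filling
  | 0 => fun _ => 0
  | k + 1 => fun c =>
      if insertionTableau a (k + 1) c ≠ 0 ∧ insertionTableau a k c = 0 then k + 1
      else recordingTableau a k c

/-- The one-line notation of a permutation of `Fin n`, as a word in `1, …, n`. -/
def word {n : ℕ} (w : Equiv.Perm (Fin n)) (k : ℕ) : ℕ :=
  if h : k < n then (w ⟨k, h⟩ : ℕ) + 1 else 0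

/-- The tableau `P(w)`. -/
def P {n : ℕ} (w : Equiv.Perm (Fin n)) : Filling := insertionTableau (word w) n

/-- The tableau `Q(w)`. -/
def Q {n : ℕ} (w : Equiv.Perm (Fin n)) : Filling := recordingTableau (word w) n

/-! ### The Schützenberger evacuation process -/

/-- One move of the empty box `c` in a jeu de taquin slide: it is exchanged with the smaller
one of its neighbours on the right and below; if there are none, it does not move. -/
def slideNext (T : Filling) (c : ℕ × ℕ) : ℕ × ℕ :=
  if T (c.1, c.2 + 1) = 0 ∧ T (c.1 + 1, c.2) = 0 then c
  else if T (c.1 + 1, c.2) = 0 ∨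
      (T (c.1, c.2 + 1) ≠ 0 ∧ T (c.1, c.2 + 1) < T (c.1 + 1, c.2)) then (c.1, c.2 + 1)
  else (c.1 + 1, c.2)

open Classical in
/-- Erase the entry of the upper left box and perform the jeu de taquin slide into it: along
the path of the empty box every entry moves one step towards the upper left corner, and the
last box of the path is vacated. -/
def slide (T : Filling) : Filling := fun c =>
  if ∃ k : ℕ, (slideNext T)^[k] (0, 0) = c then
    (if slideNext T c = c then 0 else T (slideNext T c))
  else T c

/-- The evacuation tableau of a tableau with `n` boxes: the boxes vacated by the successive
slides are labelled by `n, n - 1, …, 1`. -/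
def ev : ℕ → Filling → Filling
  | 0, _ => fun _ => 0
  | n + 1, T => fun c => if T c ≠ 0 ∧ slide T c = 0 then n + 1 else ev n (slide T) c

/-- The modified recording tableau `Q̃(w) = ev Q(w)`. -/
def Qtilde {n : ℕ} (w : Equiv.Perm (Fin n)) : Filling := ev n (Q w)

/-! ### Cocharge tableaux -/

/-- The box `v_T(i)` in which the entry `i` of `T` lies. -/
def box (T : Filling) (i : ℕ) : ℕ × ℕ := Function.invFun T i

/-- The set of descending indices `Dsi(S)` of a standard tableau `S` with `n` boxes. -/
def Dsi (n : ℕ) (S : Filling) : Finset ℕ :=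
  (Finset.Ico 1 n).filter fun i =>
    (box S i).1 < (box S (i + 1)).1 ∧ (box S (i + 1)).2 ≤ (box S i).2

/-- The cocharge tableau `ct(S)` of a standard tableau `S` with `n` boxes: the entry `p` is
replaced by the number of descending indices smaller than `p`. The value `0` is a genuine
entry here, and the boxes of `ct(S)` are those of `S`. -/
def ct (n : ℕ) (S : Filling) : ℕ × ℕ → ℕ := fun c =>
  ((Dsi n S).filter fun i => i < S c).card

/-! ### Higher Specht polynomials

The variable `x_{i+1}` is `MvPolynomial.X i` for `i : Fin n`, and similarly `i : Fin n` stands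
for the element `i + 1` of the set `{1, …, n}` on which the symmetric group acts. -/

/-- The group `R(T)` of the permutations that preserve the rows of `T`. -/
def rowGroup (n : ℕ) (T : Filling) : Subgroup (Equiv.Perm (Fin n)) where
  carrier := {σ | ∀ i : Fin n, (box T (σ i + 1)).1 = (box T (i + 1)).1}
  one_mem' := fun _ => rfl
  mul_mem' := fun {σ τ} hσ hτ i => (hσ (τ i)).trans (hτ i)
  inv_mem' := fun {σ} hσ i => by
    have h := hσ (σ⁻¹ i)
    rw [show σ (σ⁻¹ i) = i from σ.apply_symm_apply i] at h
    exact h.symm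

/-- The group `C(T)` of the permutations that preserve the columns of `T`. -/
def colGroup (n : ℕ) (T : Filling) : Subgroup (Equiv.Perm (Fin n)) where
  carrier := {σ | ∀ i : Fin n, (box T (σ i + 1)).2 = (box T (i + 1)).2}
  one_mem' := fun _ => rfl
  mul_mem' := fun {σ τ} hσ hτ i => (hσ (τ i)).trans (hτ i)
  inv_mem' := fun {σ} hσ i => by
    have h := hσ (σ⁻¹ i)
    rw [show σ (σ⁻¹ i) = i from σ.apply_symm_apply i] at h
    exact h.symm

open Classical in
/-- The Young symmetrizer `ε_T = ∑_{σ ∈ C(T)} ∑_{τ ∈ R(T)} sgn(σ) σ τ` in the group ring. -/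
def youngSymmetrizer (n : ℕ) (T : Filling) : MonoidAlgebra ℚ (Equiv.Perm (Fin n)) :=
  ∑ σ : colGroup n T, ∑ τ : rowGroup n T,
    MonoidAlgebra.single ((σ : Equiv.Perm (Fin n)) * (τ : Equiv.Perm (Fin n)))
      ((Equiv.Perm.sign (σ : Equiv.Perm (Fin n)) : ℤ) : ℚ)

/-- The action of the symmetric group on polynomials, where `σ` sends `x_i` to `x_{σ(i)}`. -/
def polyRep (n : ℕ) : Representation ℚ (Equiv.Perm (Fin n)) (MvPolynomial (Fin n) ℚ) where
  toFun σ := (MvPolynomial.rename σ).toLinearMap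
  map_one' := by
    refine LinearMap.ext fun p => ?_
    exact MvPolynomial.rename_id_apply p
  map_mul' σ τ := by
    refine LinearMap.ext fun p => ?_
    exact (MvPolynomial.rename_rename τ σ p).symm

/-- The action of an element of the group ring on a polynomial. -/
def act {n : ℕ} (a : MonoidAlgebra ℚ (Equiv.Perm (Fin n))) (p : MvPolynomial (Fin n) ℚ) :
    MvPolynomial (Fin n) ℚ :=
  (polyRep n).asAlgebraHom a p

/-- The monomial `p_T^S`, in which the exponent of `x_i` is the entry of `ct(S)` in the box
`v_T(i)`. -/
def monomialOf (n : ℕ) (T S : Filling) : MvPolynomial (Fin n) ℚ :=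
  ∏ i : Fin n, MvPolynomial.X i ^ ct n S (box T (i + 1))

/-- The size `s_T^S` of the stabilizer of `p_T^S` in `R(T)`. -/
def stabSize (n : ℕ) (T S : Filling) : ℕ :=
  Nat.card {τ : rowGroup n T // polyRep n τ (monomialOf n T S) = monomialOf n T S}

/-- The higher Specht polynomial `F_T^S = ε_T p_T^S / s_T^S`. -/
def higherSpecht (n : ℕ) (T S : Filling) : MvPolynomial (Fin n) ℚ :=
  (stabSize n T S : ℚ)⁻¹ • act (youngSymmetrizer n T) (monomialOf n T S)

/-- The higher Specht polynomial `F_w` of a permutation `w`. -/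
def F {n : ℕ} (w : Equiv.Perm (Fin n)) : MvPolynomial (Fin n) ℚ :=
  higherSpecht n (P w) (Qtilde w)

/-! ### From `n` to `n + 1` -/

/-- The permutation `w₊` of `{1, …, n + 1}` that acts on `{1, …, n}` like `w` and fixes
`n + 1`. -/
def plus {n : ℕ} (w : Equiv.Perm (Fin n)) : Equiv.Perm (Fin (n + 1)) :=
  finSuccEquivLast.symm.permCongr (Equiv.optionCongr w)

theorem plus_castSucc {n : ℕ} (w : Equiv.Perm (Fin n)) (i : Fin n) :
    plus w i.castSucc = (w i).castSucc := by
  simp [plus, Equiv.permCongr_apply]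

theorem plus_last {n : ℕ} (w : Equiv.Perm (Fin n)) :
    plus w (Fin.last n) = Fin.last n := by
  simp [plus, Equiv.permCongr_apply]

/-- A polynomial in `x_1, …, x_n`, viewed as one in `x_1, …, x_{n+1}`. -/
def inclusion (n : ℕ) : MvPolynomial (Fin n) ℚ →ₐ[ℚ] MvPolynomial (Fin (n + 1)) ℚ :=
  MvPolynomial.rename Fin.castSucc

/-- The substitution `x_{n+1} = 0`. -/
def setLastZero (n : ℕ) : MvPolynomial (Fin (n + 1)) ℚ →ₐ[ℚ] MvPolynomial (Fin n) ℚ :=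
  MvPolynomial.aeval fun i => Fin.lastCases 0 (fun j => MvPolynomial.X j) i

end HigherSpecht

end

/-!
The word of `w₊` is that of `w` followed by its largest letter, so `P(w₊)` and `Q(w₊)` arise from
`P(w)` and `Q(w)` by appending `n + 1` to the first row (`P_plus`, `Q_plus`).

During an evacuation, a largest entry at the end of the first row stays at the end of the first
row: a slide moves it to the left exactly if the slide of the remaining tableau vacates the last
box of the first row (`slide_update`). Hence the boxes vacated by the slides of `Q(w₊)` are those
of `Q(w)`, except that the ones in the first row are moved one step to the right, and `(0, 0)` is
vacated last. In other words, `Q̃(w₊)` is obtained from `Q̃(w)` by increasing all entries by one,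
shifting the first row to the right and putting `1` into the corner (`ev_update`). This only
shifts the descending indices by one (`Dsi_shiftRow`), so the cocharge tableau changes by a shift
of its first row with a new entry `0` in front. Therefore the monomials of `w₊` and `w` differ by
an element of the row group of `P(w₊)`, the rotation of the first row
(`exists_polyRep_monomialOf_eq`), and the Young symmetrizer does not see this element.

For the substitution `x_{n+1} = 0`, note that `n + 1` is alone in its column of `P(w₊)`, so that
the column groups of `P(w₊)` and `P(w)` agree, and the substitution commutes with them. The sum
over the row group of the images of a monomial, divided by the size of the stabilizer, is the sum
over the orbit (`coeff_orbitSum`). The monomials without `x_{n+1}` in the orbit under the row group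
of `P(w₊)` form the orbit under the row group of `P(w)` (`exists_mem_rowGroup_iff`), and the
substitution deletes the others (`setLastZero_act`).
-/

noncomputable section

namespace HigherSpecht

/-! ### Tableaux -/

/-- A tableau with distinct entries whose rows and columns increase. That the non-zero values
occupy a Young diagram is part of the last two conditions. -/
structure IsTableau (T : Filling) : Prop where
  finite : (Function.support T).Finite
  inj : ∀ c c', T c = T c' → T c ≠ 0 → c = c'
  row : ∀ i j, T (i, j + 1) ≠ 0 → T (i, j) ≠ 0 ∧ T (i, j) < T (i, j + 1)
  col : ∀ i j, T (i + 1, j) ≠ 0 → T (i, j) ≠ 0 ∧ T (i, j) < T (i + 1, j)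

theorem isTableau_zero : IsTableau fun _ => 0 := by
  constructor <;> simp [Function.support]

namespace IsTableau

variable {T : Filling}

theorem row_lt (hT : IsTableau T) {i j k : ℕ} (hjk : j < k) (h : T (i, k) ≠ 0) :
    T (i, j) ≠ 0 ∧ T (i, j) < T (i, k) := by
  induction k, hjk using Nat.le_induction with
  | base => exact hT.row i j h
  | succ k hk ih =>
    obtain ⟨h1, h2⟩ := hT.row i k h
    exact ⟨(ih h1).1, (ih h1).2.trans h2⟩

theorem col_lt (hT : IsTableau T) {i j k : ℕ} (hik : i < k) (h : T (k, j) ≠ 0) :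
    T (i, j) ≠ 0 ∧ T (i, j) < T (k, j) := by
  induction k, hik using Nat.le_induction with
  | base => exact hT.col i j h
  | succ k hk ih =>
    obtain ⟨h1, h2⟩ := hT.col k j h
    exact ⟨(ih h1).1, (ih h1).2.trans h2⟩

theorem corner_ne_zero (hT : IsTableau T) {c : ℕ × ℕ} (h : T c ≠ 0) : T (0, 0) ≠ 0 := by
  obtain ⟨i, j⟩ := c
  have h1 : T (i, 0) ≠ 0 := by
    rcases Nat.eq_zero_or_pos j with rfl | hj
    · exact h
    · exact (hT.row_lt hj h).1
  rcases Nat.eq_zero_or_pos i with rfl | hi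
  · exact h1
  · exact (hT.col_lt hi h1).1

theorem exists_row_eq_zero (hT : IsTableau T) (i : ℕ) : ∃ j, T (i, j) = 0 := by
  by_contra! h
  exact Set.infinite_of_injective_forall_mem (f := fun j : ℕ => (i, j))
    (fun a b hab => (Prod.ext_iff.1 hab).2) h hT.finite

/-- The number `r` provided here is the length of the first row. -/
theorem exists_rowLen (hT : IsTableau T) : ∃ r, ∀ j, T (0, j) ≠ 0 ↔ j < r := by
  classical
  refine ⟨Nat.find (hT.exists_row_eq_zero 0), fun j => ⟨fun h => ?_, fun h =>
    Nat.find_min (hT.exists_row_eq_zero 0) h⟩⟩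
  by_contra! hj
  have h0 := Nat.find_spec (hT.exists_row_eq_zero 0)
  rcases hj.eq_or_lt with hj | hj
  · exact h (hj ▸ h0)
  · exact (hT.row_lt hj h).1 h0

/-- A tableau grows by a new largest entry if the enlarged shape is still a Young diagram. -/
theorem update (hT : IsTableau T) {c : ℕ × ℕ} {N : ℕ} (hc : T c = 0) (hN : ∀ c', T c' < N)
    (hrow : ∀ j, c.2 = j + 1 → T (c.1, j) ≠ 0) (hcol : ∀ i, c.1 = i + 1 → T (i, c.2) ≠ 0) :
    IsTableau (Function.update T c N) where
  finite := (hT.finite.insert c).subset fun c' h => by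
    by_cases hcc : c' = c
    · exact Or.inl hcc
    · rw [Function.mem_support, Function.update_of_ne hcc] at h
      exact Or.inr h
  inj a b hab ha := by
    have h1 := hN a
    have h2 := hN b
    have h3 := hT.inj a b
    simp only [Function.update_apply] at hab ha
    grind
  row i j h := by
    have h1 := hN (i, j)
    have h2 := hT.row i j
    simp only [Function.update_apply] at h ⊢
    obtain ⟨c1, c2⟩ := c
    simp only [Prod.mk.injEq] at *
    grind
  col i j h := by
    have h1 := hN (i, j)
    have h2 := hT.col i j
    simp only [Function.update_apply] at h ⊢
    obtain ⟨c1, c2⟩ := c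
    simp only [Prod.mk.injEq] at *
    grind

theorem box_eq (hT : IsTableau T) {c : ℕ × ℕ} {i : ℕ} (h : T c = i) (hi : i ≠ 0) :
    box T i = c := by
  have h1 : T (box T i) = i := Function.invFun_eq ⟨c, h⟩
  exact hT.inj _ _ (h1.trans h.symm) (h1.trans_ne hi)

end IsTableau

theorem apply_box {T : Filling} {i : ℕ} (h : ∃ c, T c = i) : T (box T i) = i :=
  Function.invFun_eq h

theorem ncard_support_update {T : Filling} (hT : IsTableau T) {c : ℕ × ℕ} {N : ℕ} (hc : T c = 0)
    (hN : N ≠ 0) :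
    (Function.support (Function.update T c N)).ncard = (Function.support T).ncard + 1 := by
  have h : Function.support (Function.update T c N) = insert c (Function.support T) := by
    ext c'
    by_cases h : c' = c <;> simp [h, hN]
  rw [h, Set.ncard_insert_of_notMem (by simpa using hc) hT.finite]

/-! ### Row insertion -/

section RowInsert

variable {T : Filling} {x : ℕ}

theorem insertPos_spec (hT : IsTableau T) (i x : ℕ) :
    T (i, insertPos T i x) = 0 ∨ x < T (i, insertPos T i x) := by
  obtain ⟨j, hj⟩ := hT.exists_row_eq_zero i
  exact Nat.sInf_mem (s := {j | T (i, j) = 0 ∨ x < T (i, j)}) ⟨j, Or.inl hj⟩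

theorem of_lt_insertPos {i x j : ℕ} (h : j < insertPos T i x) : T (i, j) ≠ 0 ∧ T (i, j) ≤ x := by
  simpa [not_or] using Nat.notMem_of_lt_sInf h

theorem insertPos_le {i x j : ℕ} (h : T (i, j) = 0 ∨ x < T (i, j)) : insertPos T i x ≤ j :=
  Nat.sInf_le h

theorem bump_succ {i : ℕ} (h : bump T x (i + 1) ≠ 0) :
    bump T x i ≠ 0 ∧ T (i, insertPos T i (bump T x i)) = bump T x (i + 1) := by
  rw [bump] at h ⊢
  split_ifs at h ⊢ with h0
  · exact absurd rfl h
  · exact ⟨h0, rfl⟩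

theorem bump_succ_eq {i : ℕ} (h : bump T x i ≠ 0) :
    bump T x (i + 1) = T (i, insertPos T i (bump T x i)) := by
  rw [bump, if_neg h]

theorem bump_ne_zero_of_le {i k : ℕ} (hik : i ≤ k) (h : bump T x k ≠ 0) : bump T x i ≠ 0 := by
  induction k, hik using Nat.le_induction with
  | base => exact h
  | succ k _ ih => exact ih (bump_succ h).1

theorem bump_lt (hT : IsTableau T) {i : ℕ} (h : bump T x (i + 1) ≠ 0) :
    bump T x i < bump T x (i + 1) := by
  obtain ⟨_, h2⟩ := bump_succ h
  rcases insertPos_spec hT i (bump T x i) with h3 | h3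
  · exact absurd (h2.symm.trans h3) h
  · exact h3.trans_eq h2

theorem insertPos_bump_le (hT : IsTableau T) {i : ℕ} (h : bump T x (i + 1) ≠ 0) :
    insertPos T (i + 1) (bump T x (i + 1)) ≤ insertPos T i (bump T x i) := by
  apply insertPos_le
  by_contra! h3
  have := (hT.col _ _ h3.1).2
  rw [(bump_succ h).2] at this
  omega

/-- The number inserted into a row is different from the entries of that row. -/
theorem apply_ne_bump (hT : IsTableau T) (hx : ∀ c, T c ≠ x) {i : ℕ} (h : bump T x i ≠ 0)
    (j : ℕ) : T (i, j) ≠ bump T x i := by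
  cases i with
  | zero => exact hx _
  | succ i =>
    intro h2
    have := hT.inj _ _ (h2.trans (bump_succ h).2.symm) (h2 ▸ h)
    simp at this

theorem rowInsert_of_modified {i : ℕ} (h : bump T x i ≠ 0) :
    rowInsert T x (i, insertPos T i (bump T x i)) = bump T x i := by
  simp [rowInsert, h]

theorem rowInsert_cases (T : Filling) (x : ℕ) (c : ℕ × ℕ) :
    (bump T x c.1 ≠ 0 ∧ c.2 = insertPos T c.1 (bump T x c.1) ∧
      rowInsert T x c = bump T x c.1) ∨
    (¬ (bump T x c.1 ≠ 0 ∧ c.2 = insertPos T c.1 (bump T x c.1)) ∧ rowInsert T x c = T c) := by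
  by_cases h : bump T x c.1 ≠ 0 ∧ c.2 = insertPos T c.1 (bump T x c.1)
  · exact Or.inl ⟨h.1, h.2, by simp only [rowInsert, if_pos h]⟩
  · exact Or.inr ⟨h, by simp only [rowInsert, if_neg h]⟩

theorem exists_rowInsert_eq (hx0 : x ≠ 0) {v : ℕ} (hv : v ≠ 0) :
    (∃ c, rowInsert T x c = v) ↔ v = x ∨ ∃ c, T c = v := by
  constructor
  · rintro ⟨⟨i, j⟩, rfl⟩
    rcases rowInsert_cases T x (i, j) with ⟨h1, h2, h3⟩ | ⟨h1, h2⟩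
    · rw [h3]
      cases i with
      | zero => exact Or.inl rfl
      | succ i => exact Or.inr ⟨_, (bump_succ h1).2⟩
    · exact Or.inr ⟨_, h2.symm⟩
  · rintro (rfl | ⟨⟨i, j⟩, rfl⟩)
    · exact ⟨_, rowInsert_of_modified (i := 0) hx0⟩
    · rcases rowInsert_cases T x (i, j) with ⟨h1, h2, h3⟩ | ⟨h1, h2⟩
      · have h4 : bump T x (i + 1) = T (i, j) := by
          rw [bump_succ_eq h1, ← show j = _ from h2]
        exact ⟨_, (rowInsert_of_modified (h4 ▸ hv)).trans h4⟩
      · exact ⟨_, h2⟩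

/-- Row insertion enlarges the shape by exactly one box. -/
theorem exists_new_box (hT : IsTableau T) (hx0 : x ≠ 0) :
    ∃ c, T c = 0 ∧ rowInsert T x c ≠ 0 ∧ ∀ c', c' ≠ c → (rowInsert T x c' ≠ 0 ↔ T c' ≠ 0) := by
  classical
  have hex : ∃ i, bump T x i = 0 := by
    by_contra! h
    refine Set.infinite_of_injective_forall_mem
      (f := fun i : ℕ => (i, insertPos T i (bump T x i)))
      (fun a b hab => (Prod.ext_iff.1 hab).1) (fun i => ?_) hT.finite
    rw [Function.mem_support, ← bump_succ_eq (h i)]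
    exact h (i + 1)
  obtain ⟨m, hm⟩ : ∃ m, Nat.find hex = m + 1 := Nat.exists_eq_succ_of_ne_zero fun h =>
    hx0 (by simpa [h, bump] using Nat.find_spec hex)
  have hm0 : bump T x m ≠ 0 := Nat.find_min hex (by omega)
  have hm1 : bump T x (m + 1) = 0 := hm ▸ Nat.find_spec hex
  refine ⟨(m, insertPos T m (bump T x m)), (bump_succ_eq hm0).symm.trans hm1, ?_, ?_⟩
  · rw [rowInsert_of_modified hm0]
    exact hm0
  · rintro ⟨i, j⟩ hij
    rcases rowInsert_cases T x (i, j) with ⟨h1, h2, h3⟩ | ⟨h1, h2⟩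
    · dsimp only at h1 h2 h3
      subst h2
      rw [h3, ← bump_succ_eq h1]
      have him : i < m + 1 := by
        by_contra! h
        exact bump_ne_zero_of_le h h1 hm1
      have : i ≠ m := by
        rintro rfl
        exact hij rfl
      exact iff_of_true h1 (bump_ne_zero_of_le (by omega) hm0)
    · rw [h2]

/-- Row insertion preserves tableaux: the bumped numbers increase from row to row, while the
columns in which they are inserted move weakly to the left. -/
theorem IsTableau.rowInsert (hT : IsTableau T) (hx0 : x ≠ 0) (hx : ∀ c, T c ≠ x) :
    IsTableau (rowInsert T x) where
  finite := by
    obtain ⟨c, _, _, h⟩ := exists_new_box hT hx0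
    refine (hT.finite.insert c).subset fun c' hc' => ?_
    by_cases hcc : c' = c
    · exact Or.inl hcc
    · exact Or.inr ((h c' hcc).1 hc')
  inj := by
    -- an entry of a modified box is either `x` or was bumped out of a box of the previous row
    have key : ∀ i c', bump T x i ≠ 0 →
        ¬ (bump T x c'.1 ≠ 0 ∧ c'.2 = insertPos T c'.1 (bump T x c'.1)) →
        bump T x i ≠ T c' := by
      intro i c' hi hc' h
      cases i with
      | zero => exact hx c' h.symm
      | succ i =>
        obtain ⟨h1, h2⟩ := bump_succ hi
        have := hT.inj _ _ (h2.trans h) (h2 ▸ hi)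
        subst this
        exact hc' ⟨h1, rfl⟩
    have mono : ∀ i k, i < k → bump T x k ≠ 0 → bump T x i < bump T x k := by
      intro i k hik hk
      induction k, hik using Nat.le_induction with
      | base => exact bump_lt hT hk
      | succ k _ ih => exact (ih (bump_succ hk).1).trans (bump_lt hT hk)
    rintro ⟨i, j⟩ ⟨k, l⟩ h h0
    rcases rowInsert_cases T x (i, j) with ⟨h1, h2, h3⟩ | ⟨h1, h3⟩ <;>
      rcases rowInsert_cases T x (k, l) with ⟨h4, h5, h6⟩ | ⟨h4, h6⟩ <;>
      rw [h3, h6] at h <;> rw [h3] at h0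
    · dsimp only at *
      have hik : i = k := by
        rcases lt_trichotomy i k with hik | hik | hik
        · exact absurd h (mono _ _ hik h4).ne
        · exact hik
        · exact absurd h (mono _ _ hik h1).ne'
      subst hik
      rw [h2, h5]
    · exact absurd h (key _ _ h1 h4)
    · exact absurd h.symm (key _ _ h4 h1)
    · exact hT.inj _ _ h h0
  row i j h := by
    have hs := insertPos_spec hT i (bump T x i)
    have hlt := @of_lt_insertPos T i (bump T x i) j
    have hne := fun h0 => apply_ne_bump hT hx (i := i) h0 j
    have hr := hT.row i j
    rcases rowInsert_cases T x (i, j) with ⟨h1, h2, h3⟩ | ⟨h1, h3⟩ <;>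
      rcases rowInsert_cases T x (i, j + 1) with ⟨h4, h5, h6⟩ | ⟨h4, h6⟩ <;>
      rw [h6] at h <;> rw [h3, h6] <;> dsimp only at *
    · omega
    · rw [← h2] at hs
      have := hr h
      omega
    · have := hlt (by omega)
      have := hne h4
      omega
    · exact hr h
  col i j h := by
    have hs := insertPos_spec hT i (bump T x i)
    have hlt := @of_lt_insertPos T i (bump T x i) j
    have hr := hT.col i j
    rcases rowInsert_cases T x (i, j) with ⟨h1, h2, h3⟩ | ⟨h1, h3⟩ <;>
      rcases rowInsert_cases T x (i + 1, j) with ⟨h4, h5, h6⟩ | ⟨h4, h6⟩ <;>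
      rw [h6] at h <;> rw [h3, h6] <;> dsimp only at *
    · exact ⟨h1, bump_lt hT h4⟩
    · rw [← h2] at hs
      have := hr h
      omega
    · have h7 := insertPos_bump_le hT h4
      have h8 := bump_succ h4
      have h9 := bump_lt hT h4
      rw [← h5] at h7
      rcases h7.eq_or_lt with h7 | h7
      · exact absurd ⟨h8.1, h7⟩ h1
      · have := hlt h7
        omega
    · exact hr h

/-- Inserting a number that exceeds all entries appends it to the first row. -/
theorem rowInsert_eq_update {r : ℕ} (hr : ∀ j, T (0, j) ≠ 0 ↔ j < r) (hx : ∀ c, T c < x) :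
    rowInsert T x = Function.update T (0, r) x := by
  have hpos : insertPos T 0 x = r := by
    apply le_antisymm
    · exact insertPos_le (Or.inl (by have := hr r; simpa using this))
    · by_contra! h
      have h1 : insertPos T 0 x ∈ {j | T (0, j) = 0 ∨ x < T (0, j)} :=
        Nat.sInf_mem ⟨r, Or.inl (by have := hr r; simpa using this)⟩
      rcases h1 with h1 | h1
      · exact (hr _).2 h h1
      · exact absurd h1 (hx _).not_gt
  have hx0 : x ≠ 0 := (Nat.zero_lt_of_lt (hx (0, 0))).ne'
  have h1 : bump T x 1 = 0 := by
    rw [bump_succ_eq (i := 0) hx0]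
    change T (0, insertPos T 0 x) = 0
    rw [hpos]
    simpa using hr r
  ext ⟨i, j⟩
  rw [Function.update_apply]
  cases i with
  | zero => simp [rowInsert, bump, hpos, hx0]
  | succ i =>
    have : bump T x (i + 1) = 0 := by
      by_contra h
      exact bump_ne_zero_of_le (Nat.succ_le_succ (Nat.zero_le i)) h h1
    simp [rowInsert, this]

end RowInsert

/-! ### Insertion and recording tableaux -/

section Recording

variable {a : ℕ → ℕ} {n : ℕ}

/-- The insertion tableau of distinct positive letters is a tableau with these entries. -/
theorem insertionTableau_spec (ha : ∀ k < n, a k ≠ 0)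
    (hinj : ∀ k < n, ∀ l < n, a k = a l → k = l) {k : ℕ} (hk : k ≤ n) :
    IsTableau (insertionTableau a k) ∧
      ∀ v, v ≠ 0 → ((∃ c, insertionTableau a k c = v) ↔ ∃ l < k, a l = v) := by
  induction k with
  | zero => exact ⟨isTableau_zero, fun v hv => by simp [insertionTableau, hv.symm]⟩
  | succ k ih =>
    obtain ⟨h1, h2⟩ := ih (by omega)
    have hak := ha k (by omega)
    refine ⟨h1.rowInsert hak fun c hc => ?_, fun v hv => ?_⟩
    · obtain ⟨l, hl, hl'⟩ := (h2 _ hak).1 ⟨c, hc⟩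
      have := hinj l (by omega) k (by omega) hl'
      omega
    · rw [insertionTableau, exists_rowInsert_eq hak hv, h2 v hv]
      constructor
      · rintro (rfl | ⟨l, hl, rfl⟩)
        · exact ⟨k, by omega, rfl⟩
        · exact ⟨l, by omega, rfl⟩
      · rintro ⟨l, hl, rfl⟩
        rcases (Nat.lt_succ_iff.1 hl).eq_or_lt with rfl | hl
        · exact Or.inl rfl
        · exact Or.inr ⟨l, hl, rfl⟩

/-- The recording tableau has the shape of the insertion tableau. The number of its boxes is what
determines the number of steps of the evacuation. -/
theorem recordingTableau_spec (ha : ∀ k < n, a k ≠ 0)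
    (hinj : ∀ k < n, ∀ l < n, a k = a l → k = l) {k : ℕ} (hk : k ≤ n) :
    IsTableau (recordingTableau a k) ∧ (∀ c, recordingTableau a k c ≤ k) ∧
      (∀ c, recordingTableau a k c ≠ 0 ↔ insertionTableau a k c ≠ 0) ∧
      (Function.support (recordingTableau a k)).ncard = k := by
  induction k with
  | zero => exact ⟨isTableau_zero, by simp [recordingTableau, insertionTableau]⟩
  | succ k ih =>
    obtain ⟨h1, h2, h3, h4⟩ := ih (by omega)
    have hP := (insertionTableau_spec ha hinj (k := k) (by omega)).1
    have hP' := (insertionTableau_spec ha hinj hk).1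
    obtain ⟨c, hc0, hc1, hc2⟩ := exists_new_box hP (ha k (by omega))
    have hc1' : insertionTableau a (k + 1) c ≠ 0 := hc1
    have hQc : recordingTableau a k c = 0 := by
      have := h3 c
      tauto
    have heq : recordingTableau a (k + 1) = Function.update (recordingTableau a k) c (k + 1) := by
      ext c'
      rw [Function.update_apply, recordingTableau]
      by_cases hcc : c' = c
      · subst hcc
        simp [hc1', hc0]
      · have : insertionTableau a (k + 1) c' ≠ 0 ↔ insertionTableau a k c' ≠ 0 := hc2 c' hcc
        rw [if_neg hcc]
        exact if_neg (by tauto)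
    rw [heq]
    refine ⟨h1.update hQc (fun c' => Nat.lt_succ_of_le (h2 c')) ?_ ?_, ?_, ?_, ?_⟩
    · obtain ⟨c1, c2⟩ := c
      rintro j rfl
      exact (h3 _).2 ((hc2 _ (by simp)).1 (hP'.row _ _ hc1').1)
    · obtain ⟨c1, c2⟩ := c
      rintro j rfl
      exact (h3 _).2 ((hc2 _ (by simp)).1 (hP'.col _ _ hc1').1)
    · intro c'
      rw [Function.update_apply]
      have := h2 c'
      split_ifs <;> omega
    · intro c'
      rw [Function.update_apply]
      split_ifs with hcc
      · subst hcc
        simp [hc1']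
      · rw [h3]
        exact (hc2 c' hcc).symm
    · rw [ncard_support_update h1 hQc (by omega), h4]

theorem insertionTableau_congr {b : ℕ → ℕ} (h : ∀ k < n, a k = b k) {k : ℕ} (hk : k ≤ n) :
    insertionTableau a k = insertionTableau b k := by
  induction k with
  | zero => rfl
  | succ k ih => rw [insertionTableau, insertionTableau, ih (by omega), h k (by omega)]

theorem recordingTableau_congr {b : ℕ → ℕ} (h : ∀ k < n, a k = b k) {k : ℕ} (hk : k ≤ n) :
    recordingTableau a k = recordingTableau b k := by
  induction k with
  | zero => rfl
  | succ k ih =>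
    ext c
    rw [recordingTableau, recordingTableau, ih (by omega), insertionTableau_congr h hk,
      insertionTableau_congr h (by omega : k ≤ n)]

end Recording

section Word

variable {n : ℕ} (w : Equiv.Perm (Fin n))

theorem word_ne_zero : ∀ k < n, word w k ≠ 0 := fun k hk => by simp [word, hk]

theorem word_inj : ∀ k < n, ∀ l < n, word w k = word w l → k = l := fun k hk l hl h => by
  simpa [word, hk, hl, Fin.val_inj] using h

theorem P_isTableau : IsTableau (P w) :=
  (insertionTableau_spec (word_ne_zero w) (word_inj w) le_rfl).1

theorem exists_P_eq {v : ℕ} (hv : v ≠ 0) : (∃ c, P w c = v) ↔ v ≤ n := by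
  refine ((insertionTableau_spec (word_ne_zero w) (word_inj w) le_rfl).2 v hv).trans
    ⟨?_, fun h => ?_⟩
  · rintro ⟨l, hl, rfl⟩
    simp [word, hl]
  · refine ⟨w.symm ⟨v - 1, by omega⟩, Fin.is_lt _, ?_⟩
    simp [word]
    omega

theorem P_le (c : ℕ × ℕ) : P w c ≤ n := by
  by_cases h : P w c = 0
  · omega
  · exact (exists_P_eq w h).1 ⟨c, rfl⟩

theorem Q_isTableau : IsTableau (Q w) :=
  (recordingTableau_spec (word_ne_zero w) (word_inj w) le_rfl).1

theorem Q_le (c : ℕ × ℕ) : Q w c ≤ n :=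
  (recordingTableau_spec (word_ne_zero w) (word_inj w) le_rfl).2.1 c

theorem Q_ne_zero_iff (c : ℕ × ℕ) : Q w c ≠ 0 ↔ P w c ≠ 0 :=
  (recordingTableau_spec (word_ne_zero w) (word_inj w) le_rfl).2.2.1 c

theorem ncard_support_Q : (Function.support (Q w)).ncard = n :=
  (recordingTableau_spec (word_ne_zero w) (word_inj w) le_rfl).2.2.2

theorem word_plus : ∀ k < n, word (plus w) k = word w k := fun k hk => by
  have h := plus_castSucc w ⟨k, hk⟩
  simp only [Fin.castSucc_mk] at h
  simp [word, hk, Nat.lt_succ_of_lt hk, h]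

theorem word_plus_last : word (plus w) n = n + 1 := by
  have h := plus_last w
  simp only [Fin.last] at h
  simp [word, h]

theorem P_plus {r : ℕ} (hr : ∀ j, P w (0, j) ≠ 0 ↔ j < r) :
    P (plus w) = Function.update (P w) (0, r) (n + 1) := by
  have h : insertionTableau (word (plus w)) n = P w :=
    insertionTableau_congr (word_plus w) le_rfl
  rw [P, insertionTableau, h, word_plus_last]
  exact rowInsert_eq_update hr fun c => Nat.lt_succ_of_le (P_le w c)

theorem Q_plus {r : ℕ} (hr : ∀ j, P w (0, j) ≠ 0 ↔ j < r) :
    Q (plus w) = Function.update (Q w) (0, r) (n + 1) := by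
  have h : insertionTableau (word (plus w)) n = P w :=
    insertionTableau_congr (word_plus w) le_rfl
  have h' : insertionTableau (word (plus w)) (n + 1) = Function.update (P w) (0, r) (n + 1) :=
    P_plus w hr
  have h2 : recordingTableau (word (plus w)) n = Q w :=
    recordingTableau_congr (word_plus w) le_rfl
  have hr0 : P w (0, r) = 0 := by simpa using hr r
  ext c
  rw [Q, recordingTableau, h, h', h2]
  simp only [Function.update_apply]
  by_cases hc : c = (0, r)
  · simp [hc, hr0]
  · simp [hc]

end Word

/-! ### Jeu de taquin slides -/

/-- The box `c` lies on the path of the empty box of the slide into the upper left corner. -/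
def OnPath (T : Filling) (c : ℕ × ℕ) : Prop := ∃ k : ℕ, (slideNext T)^[k] (0, 0) = c

section Slide

variable {T : Filling}

theorem onPath_zero : OnPath T (0, 0) := ⟨0, rfl⟩

theorem OnPath.next {c : ℕ × ℕ} (h : OnPath T c) : OnPath T (slideNext T c) := by
  obtain ⟨k, rfl⟩ := h
  exact ⟨k + 1, Function.iterate_succ_apply' _ _ _⟩

theorem OnPath.induction {p : ℕ × ℕ → Prop} (h0 : p (0, 0))
    (hs : ∀ c, OnPath T c → p c → p (slideNext T c)) {c : ℕ × ℕ} (h : OnPath T c) : p c := by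
  obtain ⟨k, rfl⟩ := h
  induction k with
  | zero => exact h0
  | succ k ih =>
    rw [Function.iterate_succ_apply']
    exact hs _ ⟨k, rfl⟩ ih

theorem slide_of_onPath {c : ℕ × ℕ} (h : OnPath T c) :
    slide T c = if slideNext T c = c then 0 else T (slideNext T c) :=
  if_pos h

theorem slide_of_not_onPath {c : ℕ × ℕ} (h : ¬ OnPath T c) : slide T c = T c :=
  if_neg h

theorem slideNext_cases (T : Filling) (i j : ℕ) :
    (slideNext T (i, j) = (i, j) ∧ T (i, j + 1) = 0 ∧ T (i + 1, j) = 0) ∨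
    (slideNext T (i, j) = (i, j + 1) ∧ T (i, j + 1) ≠ 0 ∧
      (T (i + 1, j) = 0 ∨ T (i, j + 1) < T (i + 1, j))) ∨
    (slideNext T (i, j) = (i + 1, j) ∧ T (i + 1, j) ≠ 0 ∧
      (T (i, j + 1) = 0 ∨ T (i + 1, j) ≤ T (i, j + 1))) := by
  simp only [slideNext]
  split_ifs with h1 h2
  · exact Or.inl ⟨rfl, h1⟩
  · exact Or.inr (Or.inl ⟨rfl, by omega, by omega⟩)
  · exact Or.inr (Or.inr ⟨rfl, by omega, by omega⟩)

theorem slideNext_ne {c : ℕ × ℕ} (h : slideNext T c ≠ c) :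
    T (slideNext T c) ≠ 0 ∧ (slideNext T c).1 + (slideNext T c).2 = c.1 + c.2 + 1 := by
  obtain ⟨i, j⟩ := c
  rcases slideNext_cases T i j with ⟨h1, h2⟩ | ⟨h1, h2⟩ | ⟨h1, h2⟩
  · exact absurd h1 h
  · rw [h1]
    exact ⟨h2.1, by dsimp only; omega⟩
  · rw [h1]
    exact ⟨h2.1, by dsimp only; omega⟩

theorem lt_slideNext (hT : IsTableau T) {c : ℕ × ℕ} (h : slideNext T c ≠ c) :
    T c < T (slideNext T c) := by
  obtain ⟨i, j⟩ := c
  rcases slideNext_cases T i j with ⟨h1, h2⟩ | ⟨h1, h2⟩ | ⟨h1, h2⟩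
  · exact absurd h1 h
  · rw [h1]
    exact (hT.row _ _ h2.1).2
  · rw [h1]
    exact (hT.col _ _ h2.1).2

theorem OnPath.apply_ne_zero (h0 : T (0, 0) ≠ 0) {c : ℕ × ℕ} (h : OnPath T c) : T c ≠ 0 := by
  refine OnPath.induction (p := fun c => T c ≠ 0) h0 (fun c _ hc => ?_) h
  by_cases h1 : slideNext T c = c
  · rwa [h1]
  · exact (slideNext_ne h1).1

/-- As long as the empty box moves, it lies on the antidiagonal numbered by its moves. -/
theorem iterate_slideNext {k : ℕ}
    (h : slideNext T ((slideNext T)^[k] (0, 0)) ≠ (slideNext T)^[k] (0, 0)) :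
    ((slideNext T)^[k] (0, 0)).1 + ((slideNext T)^[k] (0, 0)).2 = k := by
  induction k with
  | zero => rfl
  | succ k ih =>
    rw [Function.iterate_succ_apply'] at h ⊢
    have h1 : slideNext T ((slideNext T)^[k] (0, 0)) ≠ (slideNext T)^[k] (0, 0) :=
      fun h2 => h (congrArg _ h2)
    rw [(slideNext_ne h1).2, ih h1]

theorem OnPath.eq_of_next_eq {c d : ℕ × ℕ} (hc : OnPath T c) (hd : OnPath T d)
    (hc' : slideNext T c ≠ c) (hd' : slideNext T d ≠ d) (h : slideNext T c = slideNext T d) :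
    c = d := by
  have h1 := (slideNext_ne hc').2
  have h2 := (slideNext_ne hd').2
  obtain ⟨k, rfl⟩ := hc
  obtain ⟨l, rfl⟩ := hd
  rw [h, h2, iterate_slideNext hc', iterate_slideNext hd'] at h1
  rw [show k = l by omega]

/-- The slide ends: it vacates exactly one box. -/
theorem exists_vacated (hT : IsTableau T) (h0 : T (0, 0) ≠ 0) :
    ∃ e, OnPath T e ∧ slideNext T e = e ∧ ∀ c, OnPath T c → slideNext T c = c → c = e := by
  obtain ⟨k, hk⟩ : ∃ k, slideNext T ((slideNext T)^[k] (0, 0)) = (slideNext T)^[k] (0, 0) := by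
    by_contra! h
    refine Set.infinite_of_injective_forall_mem (f := fun k => (slideNext T)^[k] (0, 0))
      (fun k l hkl => ?_) (fun k => OnPath.apply_ne_zero h0 ⟨k, rfl⟩) hT.finite
    dsimp only at hkl
    rw [← iterate_slideNext (h k), ← iterate_slideNext (h l), hkl]
  refine ⟨_, ⟨k, rfl⟩, hk, ?_⟩
  rintro _ ⟨l, rfl⟩ hl
  rcases le_total k l with hkl | hkl <;> obtain ⟨m, rfl⟩ := Nat.exists_eq_add_of_le' hkl
  · rw [Function.iterate_add_apply, Function.iterate_fixed hk]
  · rw [Function.iterate_add_apply, Function.iterate_fixed hl]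

theorem slide_eq_zero_iff (h0 : T (0, 0) ≠ 0) {e : ℕ × ℕ} (he : OnPath T e)
    (he' : slideNext T e = e) (hu : ∀ c, OnPath T c → slideNext T c = c → c = e) (c : ℕ × ℕ) :
    slide T c = 0 ↔ T c = 0 ∨ c = e := by
  by_cases hc : OnPath T c
  · rw [slide_of_onPath hc]
    split_ifs with h
    · simp [hu c hc h]
    · have h1 : c ≠ e := by
        rintro rfl
        exact h he'
      simp [(slideNext_ne h).1, hc.apply_ne_zero h0, h1]
  · have h1 : c ≠ e := by
      rintro rfl
      exact hc he
    simp [slide_of_not_onPath hc, h1]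

theorem slide_le_of_forall_le {m : ℕ} (h : ∀ c, T c ≤ m) (c : ℕ × ℕ) : slide T c ≤ m := by
  unfold slide
  split_ifs
  · exact Nat.zero_le m
  · exact h _
  · exact h _

theorem slide_eq_zero (hT : IsTableau T) {c : ℕ × ℕ} (h : T c = 0) : slide T c = 0 := by
  by_cases hc : OnPath T c
  · rw [slide_of_onPath hc]
    split_ifs with h1
    · rfl
    · obtain ⟨i, j⟩ := c
      rcases slideNext_cases T i j with ⟨h3, -⟩ | ⟨-, h4, -⟩ | ⟨-, h4, -⟩
      · exact absurd h3 h1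
      · exact absurd h (hT.row _ _ h4).1
      · exact absurd h (hT.col _ _ h4).1
  · rwa [slide_of_not_onPath hc]

/-- A slide preserves tableaux. No box that stays occupied gets a smaller entry, and the entry
moved into a box of the path is smaller than the neighbour that was not chosen, while the chosen
neighbour lies on the path and so is itself replaced by a larger entry. -/
theorem isTableau_slide (hT : IsTableau T) : IsTableau (slide T) := by
  have ge : ∀ c, slide T c ≠ 0 → T c ≤ slide T c ∧ (OnPath T c → T c < slide T c) := by
    intro c h
    by_cases hc : OnPath T c
    · rw [slide_of_onPath hc] at h ⊢
      split_ifs at h ⊢ with h1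
      · exact absurd rfl h
      · exact ⟨(lt_slideNext hT h1).le, fun _ => lt_slideNext hT h1⟩
    · rw [slide_of_not_onPath hc]
      exact ⟨le_rfl, fun h => absurd h hc⟩
  constructor
  · exact hT.finite.subset fun c hc h => hc (slide_eq_zero hT h)
  · intro c d h hc
    by_cases h1 : OnPath T c <;> by_cases h2 : OnPath T d
    · rw [slide_of_onPath h1] at h hc
      rw [slide_of_onPath h2] at h
      by_cases h3 : slideNext T c = c
      · exact absurd (if_pos h3) hc
      rw [if_neg h3] at h hc
      split_ifs at h with h4
      · exact absurd h hc
      · exact h1.eq_of_next_eq h2 h3 h4 (hT.inj _ _ h hc)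
    · rw [slide_of_onPath h1, slide_of_not_onPath h2] at h
      rw [slide_of_onPath h1] at hc
      split_ifs at h hc with h3
      · exact absurd rfl hc
      · exact absurd (hT.inj _ _ h hc ▸ h1.next) h2
    · rw [slide_of_not_onPath h1, slide_of_onPath h2] at h
      rw [slide_of_not_onPath h1] at hc
      split_ifs at h with h3
      · exact absurd h hc
      · exact absurd (hT.inj _ _ h hc ▸ h2.next) h1
    · rw [slide_of_not_onPath h1, slide_of_not_onPath h2] at h
      rw [slide_of_not_onPath h1] at hc
      exact hT.inj _ _ h hc
  · intro i j h
    obtain ⟨g1, g2⟩ := ge _ h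
    have hne : T (i, j + 1) ≠ 0 := fun h1 => h (slide_eq_zero hT h1)
    have hr := hT.row i j hne
    by_cases hp : OnPath T (i, j)
    · have hn := hp.next
      rw [slide_of_onPath hp]
      rcases slideNext_cases T i j with ⟨h3, h4⟩ | ⟨h3, h4⟩ | ⟨h3, h4⟩ <;> rw [h3] at hn ⊢
      · exact absurd h4.1 hne
      · have := g2 hn
        rw [if_neg (by simp)]
        exact ⟨h4.1, this⟩
      · rw [if_neg (by simp)]
        refine ⟨h4.1, lt_of_lt_of_le (lt_of_le_of_ne (h4.2.resolve_left hne) fun h5 => ?_) g1⟩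
        simpa using hT.inj _ _ h5 h4.1
    · rw [slide_of_not_onPath hp]
      exact ⟨hr.1, hr.2.trans_le g1⟩
  · intro i j h
    obtain ⟨g1, g2⟩ := ge _ h
    have hne : T (i + 1, j) ≠ 0 := fun h1 => h (slide_eq_zero hT h1)
    have hr := hT.col i j hne
    by_cases hp : OnPath T (i, j)
    · have hn := hp.next
      rw [slide_of_onPath hp]
      rcases slideNext_cases T i j with ⟨h3, h4⟩ | ⟨h3, h4⟩ | ⟨h3, h4⟩ <;> rw [h3] at hn ⊢
      · exact absurd h4.2 hne
      · rw [if_neg (by simp)]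
        exact ⟨h4.1, (h4.2.resolve_left hne).trans_le g1⟩
      · have := g2 hn
        rw [if_neg (by simp)]
        exact ⟨h4.1, this⟩
    · rw [slide_of_not_onPath hp]
      exact ⟨hr.1, hr.2.trans_le g1⟩

/-- A largest entry at the end of the first row stays at the end of the first row during a
slide: it moves to the left exactly if the slide of the remaining tableau vacates the last box
of the first row. -/
theorem slide_update (h0 : T (0, 0) ≠ 0) {r N : ℕ} (hr : ∀ j, T (0, j) ≠ 0 ↔ j < r)
    (hcol : ∀ j, T (0 + 1, j) ≠ 0 → T (0, j) ≠ 0)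
    (hN : ∀ c, T c < N) {e : ℕ × ℕ} (he : OnPath T e) (he' : slideNext T e = e)
    (hu : ∀ c, OnPath T c → slideNext T c = c → c = e) :
    (e.1 = 0 ∧ e.2 + 1 = r ∧
      slide (Function.update T (0, r) N) = Function.update (slide T) e N) ∨
    (e.1 ≠ 0 ∧ slide (Function.update T (0, r) N) = Function.update (slide T) (0, r) N) := by
  set U : Filling := Function.update T (0, r) N with hU
  have hr0 : T (0, r) = 0 := by simpa using hr r
  have hN0 : N ≠ 0 := (Nat.zero_lt_of_lt (hN (0, 0))).ne'
  have hUr : U (0, r) = N := Function.update_self ..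
  have hUT : ∀ c, c ≠ (0, r) → U c = T c := fun c hc => Function.update_of_ne hc ..
  have hnp : ¬ OnPath T (0, r) := fun h => h.apply_ne_zero h0 hr0
  have hr1 : 0 < r := (hr 0).1 h0
  have hlast : T (0, r - 1) ≠ 0 := (hr _).2 (by omega)
  -- the new entry influences only a move of the empty box out of the last box of the first row
  have hnext : ∀ c, T c ≠ 0 → (c = (0, r - 1) → slideNext T c ≠ c) →
      slideNext U c = slideNext T c := by
    rintro ⟨i, j⟩ hc hc'
    have hdown : U (i + 1, j) = T (i + 1, j) := hUT _ (by simp)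
    by_cases hright : (i, j + 1) = (0, r)
    · obtain ⟨rfl, rfl⟩ := Prod.mk.inj hright
      have h1 := hc' (by simp)
      have h2 := hN (0 + 1, j)
      rcases slideNext_cases T 0 j with ⟨h3, h4⟩ | ⟨h3, h4⟩ | ⟨h3, h4⟩
      · exact absurd h3 h1
      · exact absurd hr0 h4.1
      · rw [h3]
        simp only [slideNext, hdown, hUr]
        rw [if_neg (by omega), if_neg (by omega)]
    · simp only [slideNext, hdown, hUT _ hright]
  by_cases hcase : e = (0, r - 1)
  · -- the empty box stops in the last box of the first row of `T`, and makes one more move in `U`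
    left
    subst hcase
    have hdown : T (0 + 1, r - 1) = 0 := by
      rcases slideNext_cases T 0 (r - 1) with h3 | ⟨h3, h4⟩ | ⟨h3, h4⟩
      · exact h3.2.2
      · rw [he'] at h3
        simp at h3
      · rw [he'] at h3
        simp at h3
    have hr2 : r - 1 + 1 = r := by omega
    have hnext1 : slideNext U (0, r - 1) = (0, r) := by
      have h1 : U (0 + 1, r - 1) = 0 := (hUT _ (by simp)).trans hdown
      simp only [slideNext, hr2, hUr, h1]
      simp [hN0]
    have hnext2 : slideNext U (0, r) = (0, r) := by
      have h1 : U (0 + 1, r) = 0 := by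
        rw [hUT _ (by simp)]
        by_contra h
        exact hcol r h hr0
      have h2 : U (0, r + 1) = 0 := by
        rw [hUT _ (by simp)]
        have := hr (r + 1)
        simpa using this
      simp [slideNext, h1, h2]
    have hpath : ∀ c, OnPath U c ↔ OnPath T c ∨ c = (0, r) := by
      intro c
      constructor
      · refine OnPath.induction (p := fun c => OnPath T c ∨ c = (0, r)) (Or.inl onPath_zero) ?_
        rintro c - (hc | rfl)
        · by_cases h1 : c = (0, r - 1)
          · subst h1
            exact Or.inr hnext1
          · rw [hnext c (hc.apply_ne_zero h0) fun h2 => absurd h2 h1]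
            exact Or.inl hc.next
        · exact Or.inr hnext2
      · have h1 : ∀ {c}, OnPath T c → OnPath U c := by
          refine OnPath.induction (p := OnPath U) onPath_zero fun c hc hc' => ?_
          by_cases h1 : c = (0, r - 1)
          · subst h1
            rwa [he']
          · rw [← hnext c (hc.apply_ne_zero h0) fun h2 => absurd h2 h1]
            exact hc'.next
        rintro (hc | rfl)
        · exact h1 hc
        · exact hnext1 ▸ (h1 he).next
    refine ⟨rfl, hr2, ?_⟩
    ext c
    rw [Function.update_apply]
    by_cases h1 : c = (0, r)
    · subst h1
      rw [slide_of_onPath ((hpath _).2 (Or.inr rfl)), if_pos hnext2, if_neg (by simp; omega),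
        slide_of_not_onPath hnp, hr0]
    by_cases h2 : c = (0, r - 1)
    · subst h2
      rw [slide_of_onPath ((hpath _).2 (Or.inl he)), hnext1, if_neg (Ne.symm h1), if_pos rfl, hUr]
    rw [if_neg h2]
    by_cases hc : OnPath T c
    · rw [slide_of_onPath ((hpath _).2 (Or.inl hc)), slide_of_onPath hc,
        hnext c (hc.apply_ne_zero h0) fun h3 => absurd h3 h2,
        hUT _ fun h3 => hnp (h3 ▸ hc.next)]
    · rw [slide_of_not_onPath (by rw [hpath]; tauto), slide_of_not_onPath hc, hUT _ h1]
  · -- the empty box takes the same path in `T` and in `U`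
    right
    have hnext' : ∀ c, OnPath T c → slideNext U c = slideNext T c := fun c hc =>
      hnext c (hc.apply_ne_zero h0) fun h1 h2 => hcase ((hu c hc h2).symm.trans h1)
    have hpath : ∀ c, OnPath U c ↔ OnPath T c := by
      intro c
      constructor
      · refine OnPath.induction (p := OnPath T) onPath_zero fun c _ hc => ?_
        rw [hnext' c hc]
        exact hc.next
      · refine OnPath.induction (p := OnPath U) onPath_zero fun c hc hc' => ?_
        rw [← hnext' c hc]
        exact hc'.next
    refine ⟨fun h1 => hcase ?_, ?_⟩
    · obtain ⟨i, j⟩ := e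
      dsimp only at h1
      subst h1
      have h2 := (hr j).1 (he.apply_ne_zero h0)
      by_contra h3
      have h4 : j + 1 < r := by
        simp only [Prod.mk.injEq, true_and] at h3
        omega
      have h5 := (hr _).2 h4
      rcases slideNext_cases T 0 j with h6 | ⟨h6, h7⟩ | ⟨h6, h7⟩
      · exact h5 h6.2.1
      · rw [he'] at h6
        simp at h6
      · rw [he'] at h6
        simp at h6
    · ext c
      rw [Function.update_apply]
      split_ifs with h1
      · subst h1
        rw [slide_of_not_onPath (by rwa [hpath]), hUr]
      · by_cases hc : OnPath T c
        · rw [slide_of_onPath ((hpath c).2 hc), slide_of_onPath hc, hnext' c hc,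
            hUT _ fun h2 => hnp (h2 ▸ hc.next)]
        · rw [slide_of_not_onPath (by rwa [hpath]), slide_of_not_onPath hc, hUT c h1]

end Slide

/-! ### Evacuation -/

section Evacuation

variable {T : Filling} {n : ℕ}

theorem IsTableau.eq_zero_of_ncard (hT : IsTableau T) (h : (Function.support T).ncard = 0) :
    T = fun _ => 0 := by
  rw [Set.ncard_eq_zero hT.finite] at h
  exact Function.support_eq_empty_iff.1 h

/-- What one step of the evacuation does: `e` is the vacated box. -/
theorem exists_ev_succ (hT : IsTableau T) (hn : (Function.support T).ncard = n + 1) :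
    T (0, 0) ≠ 0 ∧ ∃ e, (OnPath T e ∧ slideNext T e = e ∧
        ∀ c, OnPath T c → slideNext T c = c → c = e) ∧
      (∀ c, slide T c = 0 ↔ T c = 0 ∨ c = e) ∧ T e ≠ 0 ∧
      (Function.support (slide T)).ncard = n ∧
      ev (n + 1) T = Function.update (ev n (slide T)) e (n + 1) := by
  obtain ⟨c, hc⟩ : (Function.support T).Nonempty := by
    rw [← Set.ncard_pos hT.finite]
    omega
  have h0 := hT.corner_ne_zero hc
  obtain ⟨e, h1, h2, h3⟩ := exists_vacated hT h0
  have h4 := slide_eq_zero_iff h0 h1 h2 h3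
  have h5 := h1.apply_ne_zero h0
  refine ⟨h0, e, ⟨h1, h2, h3⟩, h4, h5, ?_, ?_⟩
  · have h6 : Function.support (slide T) = Function.support T \ {e} := by
      ext c
      simp [h4 c]
    rw [h6, Set.ncard_sdiff_singleton_of_mem h5, hn]
    rfl
  · ext c
    rw [Function.update_apply]
    change (if T c ≠ 0 ∧ slide T c = 0 then _ else _) = _
    by_cases hc : c = e
    · subst hc
      rw [if_pos ⟨h5, (h4 c).2 (Or.inr rfl)⟩, if_pos rfl]
    · have := h4 c
      rw [if_neg (by tauto), if_neg hc]

/-- The evacuation tableau is a standard tableau of the shape of `T`: undoing the slides, it grows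
by a new largest entry in each step. -/
theorem ev_spec (hT : IsTableau T) (hn : (Function.support T).ncard = n) :
    IsTableau (ev n T) ∧ (∀ c, ev n T c ≠ 0 ↔ T c ≠ 0) ∧ (∀ c, ev n T c ≤ n) ∧
      ∀ v, v ≠ 0 → v ≤ n → ∃ c, ev n T c = v := by
  induction n generalizing T with
  | zero =>
    rw [hT.eq_zero_of_ncard hn]
    exact ⟨isTableau_zero, by simp [ev], by simp [ev], by omega⟩
  | succ n ih =>
    obtain ⟨-, e, -, h1, h2, h3, h4⟩ := exists_ev_succ hT hn
    obtain ⟨i1, i2, i3, i4⟩ := ih (isTableau_slide hT) h3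
    have hs : ∀ c, c ≠ e → T c ≠ 0 → ev n (slide T) c ≠ 0 := fun c hc hc' => by
      rw [i2, Ne, h1]
      tauto
    have he : ev n (slide T) e = 0 := by
      have := i2 e
      have := h1 e
      tauto
    rw [h4]
    refine ⟨i1.update he (fun c => Nat.lt_succ_of_le (i3 c)) ?_ ?_, fun c => ?_, fun c => ?_, ?_⟩
    · obtain ⟨i, k⟩ := e
      rintro j rfl
      exact hs _ (by simp) (hT.row _ _ h2).1
    · obtain ⟨i, k⟩ := e
      rintro j rfl
      exact hs _ (by simp) (hT.col _ _ h2).1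
    · rw [Function.update_apply]
      split_ifs with hc
      · subst hc
        simp [h2]
      · rw [i2, Ne, h1]
        tauto
    · rw [Function.update_apply]
      have := i3 c
      split_ifs <;> omega
    · intro v hv hv'
      rcases hv'.eq_or_lt with rfl | hv'
      · exact ⟨e, Function.update_self ..⟩
      · obtain ⟨c, rfl⟩ := i4 v hv (by omega)
        refine ⟨c, Function.update_of_ne ?_ ..⟩
        rintro rfl
        exact hv he

/-- The box to which `shiftRow` moves the box `c`: boxes of the first row move to the right. -/
def shiftBox : ℕ × ℕ → ℕ × ℕ
  | (0, j) => (0, j + 1)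
  | (i + 1, j) => (i + 1, j)

/-- The tableau obtained from `S` by increasing all entries by one, moving the first row one
step to the right and putting `1` into the upper left box. -/
def shiftRow (S : Filling) : Filling
  | (0, 0) => 1
  | (0, j + 1) => if S (0, j) = 0 then 0 else S (0, j) + 1
  | (i + 1, j) => if S (i + 1, j) = 0 then 0 else S (i + 1, j) + 1

theorem shiftRow_shiftBox (S : Filling) (c : ℕ × ℕ) :
    shiftRow S (shiftBox c) = if S c = 0 then 0 else S c + 1 := by
  obtain ⟨_ | i, j⟩ := c <;> rfl

theorem shiftBox_injective : Function.Injective shiftBox := by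
  rintro ⟨_ | i, j⟩ ⟨_ | k, l⟩ h <;> simp_all [shiftBox]

theorem eq_zero_or_shiftBox (c : ℕ × ℕ) : c = (0, 0) ∨ ∃ d, c = shiftBox d := by
  obtain ⟨_ | i, _ | j⟩ := c
  · exact Or.inl rfl
  · exact Or.inr ⟨(0, j), rfl⟩
  · exact Or.inr ⟨(i + 1, 0), rfl⟩
  · exact Or.inr ⟨(i + 1, j + 1), rfl⟩

theorem shiftBox_ne (c : ℕ × ℕ) : shiftBox c ≠ (0, 0) := by
  obtain ⟨_ | i, j⟩ := c <;> simp [shiftBox]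

theorem shiftRow_update (S : Filling) (e : ℕ × ℕ) {m : ℕ} (hm : m ≠ 0) :
    shiftRow (Function.update S e m) = Function.update (shiftRow S) (shiftBox e) (m + 1) := by
  ext c
  rcases eq_zero_or_shiftBox c with rfl | ⟨d, rfl⟩
  · rw [Function.update_of_ne (shiftBox_ne e).symm]
    rfl
  · rw [shiftRow_shiftBox]
    by_cases h : d = e
    · subst h
      simp [hm]
    · rw [Function.update_of_ne h, Function.update_of_ne (shiftBox_injective.ne h),
        shiftRow_shiftBox]

/-- Evacuation turns the appending of a largest entry to the first row into the operation
`shiftRow`. -/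
theorem ev_update (hT : IsTableau T) (hn : (Function.support T).ncard = n) {r N : ℕ}
    (hr : ∀ j, T (0, j) ≠ 0 ↔ j < r) (hN : ∀ c, T c < N) :
    ev (n + 1) (Function.update T (0, r) N) = shiftRow (ev n T) := by
  have hN0 : N ≠ 0 := (Nat.zero_lt_of_lt (hN (0, 0))).ne'
  induction n generalizing T r with
  | zero =>
    have hT0 := hT.eq_zero_of_ncard hn
    subst hT0
    obtain rfl : r = 0 := by
      have := hr 0
      simpa using this
    have h1 : slide (Function.update (fun _ => 0) (0, 0) N) = fun _ => 0 := by
      have hfix : slideNext (Function.update (fun _ => 0) (0, 0) N) (0, 0) = (0, 0) := by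
        simp [slideNext]
      ext c
      by_cases hc : c = (0, 0)
      · subst hc
        rw [slide_of_onPath onPath_zero, if_pos hfix]
      · rw [slide_of_not_onPath, Function.update_of_ne hc]
        rintro ⟨k, hk⟩
        rw [Function.iterate_fixed hfix] at hk
        exact hc hk.symm
    ext c
    rcases eq_zero_or_shiftBox c with rfl | ⟨d, rfl⟩
    · simp [ev, h1, hN0, shiftRow]
    · rw [shiftRow_shiftBox]
      simp [ev, shiftBox_ne]
  | succ n ih =>
    obtain ⟨h0, e, ⟨p1, p2, p3⟩, h1, h2, h3, h4⟩ := exists_ev_succ hT hn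
    have hr0 : T (0, r) = 0 := by simpa using hr r
    have hsN : ∀ c, slide T c < N := fun c =>
      Nat.lt_of_le_pred (by omega) (slide_le_of_forall_le (fun c => Nat.le_pred_of_lt (hN c)) c)
    have hcol : ∀ j, T (0 + 1, j) ≠ 0 → T (0, j) ≠ 0 := fun j h => (hT.col _ _ h).1
    rw [h4, shiftRow_update _ _ (Nat.succ_ne_zero n)]
    rcases slide_update h0 hr hcol hN p1 p2 p3 with ⟨q1, q2, q3⟩ | ⟨q1, q2⟩
    · obtain ⟨i, r'⟩ := e
      dsimp only at q1 q2
      subst q1 q2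
      have hr' : ∀ j, slide T (0, j) ≠ 0 ↔ j < r' := fun j => by
        rw [Ne, h1, not_or, ← Ne, hr]
        simp
        omega
      rw [← ih (isTableau_slide hT) h3 hr' hsN, ← q3]
      ext c
      change (if _ then _ else _) = _
      rw [Function.update_apply]
      rw [q3]
      simp only [shiftBox, Function.update_apply]
      have h5 := h1 c
      have h6 := h1 (0, r' + 1)
      grind
    · have hr' : ∀ j, slide T (0, j) ≠ 0 ↔ j < r := fun j => by
        rw [Ne, h1, not_or, ← Ne, hr]
        refine and_iff_left ?_
        rintro rfl
        exact q1 rfl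
      rw [← ih (isTableau_slide hT) h3 hr' hsN, ← q2]
      obtain ⟨_ | i, j⟩ := e
      · exact absurd rfl q1
      ext c
      change (if _ then _ else _) = _
      rw [Function.update_apply]
      rw [q2]
      simp only [shiftBox, Function.update_apply]
      have h5 := h1 c
      grind

end Evacuation

section EvacuationOfPerm

variable {n : ℕ} (w : Equiv.Perm (Fin n))

theorem Qtilde_isTableau : IsTableau (Qtilde w) :=
  (ev_spec (Q_isTableau w) (ncard_support_Q w)).1

theorem Qtilde_ne_zero_iff (c : ℕ × ℕ) : Qtilde w c ≠ 0 ↔ P w c ≠ 0 :=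
  ((ev_spec (Q_isTableau w) (ncard_support_Q w)).2.1 c).trans (Q_ne_zero_iff w c)

theorem exists_Qtilde_eq {v : ℕ} (hv : v ≠ 0) (hv' : v ≤ n) : ∃ c, Qtilde w c = v :=
  (ev_spec (Q_isTableau w) (ncard_support_Q w)).2.2.2 v hv hv'

theorem Qtilde_plus : Qtilde (plus w) = shiftRow (Qtilde w) := by
  obtain ⟨r, hr⟩ := (P_isTableau w).exists_rowLen
  rw [Qtilde, Q_plus w hr]
  exact ev_update (Q_isTableau w) (ncard_support_Q w) (fun j => (Q_ne_zero_iff w _).trans (hr j))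
    fun c => Nat.lt_succ_of_le (Q_le w c)

end EvacuationOfPerm

/-! ### Descending indices and cocharge -/

section Cocharge

variable {n : ℕ} {S : Filling}

theorem shiftBox_fst (c : ℕ × ℕ) : (shiftBox c).1 = c.1 := by
  obtain ⟨_ | i, j⟩ := c <;> rfl

theorem shiftBox_snd (c : ℕ × ℕ) : (shiftBox c).2 = if c.1 = 0 then c.2 + 1 else c.2 := by
  obtain ⟨_ | i, j⟩ := c <;> simp [shiftBox]

/-- Moving the first row to the right creates no new descending index: if `i` lies in the first
row and `i + 1` in a lower row, then `i + 1` does not lie in the next column, as the entry above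
it would lie strictly between `i` and `i + 1`. -/
theorem Dsi_shiftRow (hS : IsTableau S) (hS' : IsTableau (shiftRow S))
    (hex : ∀ v, v ≠ 0 → v ≤ n → ∃ c, S c = v) :
    Dsi (n + 1) (shiftRow S) = (Dsi n S).image (· + 1) := by
  have hbox : ∀ v, v ≠ 0 → v ≤ n → box (shiftRow S) (v + 1) = shiftBox (box S v) := by
    intro v hv hv'
    refine hS'.box_eq ?_ (Nat.succ_ne_zero v)
    rw [shiftRow_shiftBox, apply_box (hex v hv hv'), if_neg hv]
  ext k
  simp only [Dsi, Finset.mem_filter, Finset.mem_image, Finset.mem_Ico]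
  -- in `shiftRow S` the entries `1` and `2` lie in the first row, so `1` is no descending index
  rcases Nat.lt_trichotomy k 1 with hk | rfl | hk
  · refine iff_of_false (by omega) ?_
    rintro ⟨i, hi⟩
    omega
  · refine iff_of_false ?_ ?_
    · rintro ⟨hk, h1, -⟩
      have h2 := apply_box (hex 1 one_ne_zero (by omega))
      rw [hbox 1 one_ne_zero (by omega), shiftBox_fst] at h1
      generalize box S 1 = c at h1 h2
      obtain ⟨_ | i, j⟩ := c
      · simp at h1
      · have := hS.col i j (by omega)
        omega
    · rintro ⟨i, hi⟩
      omega
  · obtain ⟨i, rfl⟩ : ∃ i, k = i + 1 := ⟨k - 1, by omega⟩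
    have hi : i ≠ 0 := by omega
    have hiff : i < n → (((box (shiftRow S) (i + 1)).1 < (box (shiftRow S) (i + 1 + 1)).1 ∧
        (box (shiftRow S) (i + 1 + 1)).2 ≤ (box (shiftRow S) (i + 1)).2) ↔
        (box S i).1 < (box S (i + 1)).1 ∧ (box S (i + 1)).2 ≤ (box S i).2) := by
      intro hin
      rw [hbox i hi hin.le, hbox (i + 1) (Nat.succ_ne_zero i) hin]
      have h1 := apply_box (hex i hi hin.le)
      have h2 := apply_box (hex (i + 1) (Nat.succ_ne_zero i) hin)
      generalize box S i = c at h1 ⊢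
      generalize box S (i + 1) = d at h2 ⊢
      obtain ⟨c1, c2⟩ := c
      obtain ⟨d1, d2⟩ := d
      simp only [shiftBox_fst, shiftBox_snd]
      by_cases hc : c1 = 0
      · subst hc
        have h3 : 0 < d1 → d2 ≠ c2 + 1 := by
          rintro h3 rfl
          have h4 := hS.col_lt h3 (by omega : S (d1, c2 + 1) ≠ 0)
          have h5 := hS.row 0 c2 h4.1
          omega
        split_ifs <;> omega
      · split_ifs <;> omega
    constructor
    · rintro ⟨h1, h2⟩
      exact ⟨i, ⟨by omega, (hiff (by omega)).1 h2⟩, rfl⟩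
    · rintro ⟨i', ⟨h1, h2⟩, h3⟩
      obtain rfl : i' = i := by omega
      exact ⟨by omega, (hiff (by omega)).2 h2⟩

theorem ct_of_eq_zero {c : ℕ × ℕ} (h : S c = 0) : ct n S c = 0 := by
  simp [ct, h]

theorem ct_shiftRow (hS : IsTableau S) (hS' : IsTableau (shiftRow S))
    (hex : ∀ v, v ≠ 0 → v ≤ n → ∃ c, S c = v) (c : ℕ × ℕ) :
    ct (n + 1) (shiftRow S) (shiftBox c) = ct n S c := by
  by_cases h : S c = 0
  · rw [ct_of_eq_zero h, ct_of_eq_zero (by rw [shiftRow_shiftBox, if_pos h])]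
  · rw [ct, ct, Dsi_shiftRow hS hS' hex, shiftRow_shiftBox, if_neg h, Finset.filter_image,
      Finset.card_image_of_injective _ (add_left_injective 1)]
    simp

theorem ct_shiftRow_zero (hS : IsTableau S) (hS' : IsTableau (shiftRow S))
    (hex : ∀ v, v ≠ 0 → v ≤ n → ∃ c, S c = v) :
    ct (n + 1) (shiftRow S) (0, 0) = 0 := by
  rw [ct, Dsi_shiftRow hS hS' hex, Finset.filter_image]
  simp [shiftRow]

end Cocharge

/-! ### Group sums over monomials -/

section Sums

variable {n : ℕ}

theorem polyRep_mul (σ τ : Equiv.Perm (Fin n)) (p : MvPolynomial (Fin n) ℚ) :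
    polyRep n (σ * τ) p = polyRep n σ (polyRep n τ p) := by
  rw [map_mul]
  rfl

theorem polyRep_monomial (σ : Equiv.Perm (Fin n)) (d : Fin n →₀ ℕ) :
    polyRep n σ (MvPolynomial.monomial d 1) = MvPolynomial.monomial (d.mapDomain σ) 1 :=
  MvPolynomial.rename_monomial _ _ _

/-- The size of the stabilizer of `p` in `H`. -/
def stabCard (H : Subgroup (Equiv.Perm (Fin n))) (p : MvPolynomial (Fin n) ℚ) : ℕ :=
  Nat.card {τ : H // polyRep n τ p = p}

theorem stabCard_ne_zero (H : Subgroup (Equiv.Perm (Fin n))) (p : MvPolynomial (Fin n) ℚ) :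
    stabCard H p ≠ 0 := by
  have : Nonempty {τ : H // polyRep n τ p = p} := ⟨⟨1, by simp⟩⟩
  exact Nat.card_pos.ne'

theorem card_polyRep_eq (H : Subgroup (Equiv.Perm (Fin n))) (p : MvPolynomial (Fin n) ℚ)
    (τ₀ : H) : Nat.card {τ : H // polyRep n τ p = polyRep n τ₀ p} = stabCard H p := by
  refine Nat.card_congr ((Equiv.mulLeft τ₀⁻¹).subtypeEquiv fun τ => ?_)
  have h : polyRep n τ p = polyRep n τ₀ (polyRep n ((τ₀⁻¹ * τ : H) : Equiv.Perm (Fin n)) p) := by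
    rw [← polyRep_mul]
    simp
  rw [h]
  exact (MvPolynomial.rename_injective _ (Equiv.injective _)).eq_iff

theorem stabCard_polyRep (H : Subgroup (Equiv.Perm (Fin n))) (p : MvPolynomial (Fin n) ℚ)
    (τ₀ : H) : stabCard H (polyRep n τ₀ p) = stabCard H p := by
  rw [← card_polyRep_eq H p τ₀]
  refine Nat.card_congr ((Equiv.mulRight τ₀).subtypeEquiv fun τ => ?_)
  rw [← polyRep_mul]
  rfl

theorem sum_polyRep_polyRep (H : Subgroup (Equiv.Perm (Fin n))) [Fintype H]
    (p : MvPolynomial (Fin n) ℚ) (τ₀ : H) :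
    ∑ τ : H, polyRep n τ (polyRep n τ₀ p) = ∑ τ : H, polyRep n τ p := by
  refine Fintype.sum_equiv (Equiv.mulRight τ₀) _ _ fun τ => ?_
  rw [← polyRep_mul]
  rfl

open Classical in
/-- Dividing the sum over a group of the images of a monomial by the size of the stabilizer
gives the sum over the orbit. -/
theorem coeff_orbitSum (H : Subgroup (Equiv.Perm (Fin n))) [Fintype H] (d e : Fin n →₀ ℕ) :
    MvPolynomial.coeff e ((stabCard H (MvPolynomial.monomial d 1) : ℚ)⁻¹ •
        ∑ τ : H, polyRep n τ (MvPolynomial.monomial d 1)) =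
      if ∃ τ ∈ H, d.mapDomain τ = e then 1 else 0 := by
  have h1 : MvPolynomial.coeff e (∑ τ : H, polyRep n τ (MvPolynomial.monomial d 1)) =
      Nat.card {τ : H // d.mapDomain (τ : Equiv.Perm (Fin n)) = e} := by
    rw [MvPolynomial.coeff_sum]
    simp only [polyRep_monomial, MvPolynomial.coeff_monomial]
    rw [Finset.sum_boole, Nat.card_eq_fintype_card, Fintype.card_subtype]
  rw [MvPolynomial.coeff_smul, h1, smul_eq_mul]
  split_ifs with h
  · obtain ⟨τ₀, hτ₀, rfl⟩ := h
    have h2 := card_polyRep_eq H (MvPolynomial.monomial d 1) ⟨τ₀, hτ₀⟩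
    simp only [polyRep_monomial,
      (MvPolynomial.monomial_left_injective (one_ne_zero (α := ℚ))).eq_iff] at h2
    rw [h2]
    exact inv_mul_cancel₀ (Nat.cast_ne_zero.2 (stabCard_ne_zero _ _))
  · have : IsEmpty {τ : H // d.mapDomain (τ : Equiv.Perm (Fin n)) = e} :=
      ⟨fun τ => h ⟨τ.1, τ.1.2, τ.2⟩⟩
    rw [Nat.card_of_isEmpty, Nat.cast_zero, mul_zero]

theorem act_youngSymmetrizer (T : Filling) [Fintype (colGroup n T)] [Fintype (rowGroup n T)]
    (p : MvPolynomial (Fin n) ℚ) :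
    act (youngSymmetrizer n T) p = ∑ σ : colGroup n T,
      ((Equiv.Perm.sign (σ : Equiv.Perm (Fin n)) : ℤ) : ℚ) •
        polyRep n σ (∑ τ : rowGroup n T, polyRep n τ p) := by
  rw [act, youngSymmetrizer]
  simp only [map_sum, LinearMap.sum_apply, Representation.asAlgebraHom_single,
    LinearMap.smul_apply, polyRep_mul, Finset.smul_sum]
  congr!

theorem act_youngSymmetrizer_polyRep (T : Filling) (p : MvPolynomial (Fin n) ℚ)
    (τ₀ : rowGroup n T) :
    act (youngSymmetrizer n T) (polyRep n τ₀ p) = act (youngSymmetrizer n T) p := by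
  classical
  rw [act_youngSymmetrizer, act_youngSymmetrizer, sum_polyRep_polyRep]

end Sums

/-! ### Permutations that fix the last element -/

section Plus

variable {n : ℕ}

theorem exists_plus_eq {σ : Equiv.Perm (Fin (n + 1))} (h : σ (Fin.last n) = Fin.last n) :
    ∃ ρ : Equiv.Perm (Fin n), plus ρ = σ := by
  have h1 : ∀ i : Fin n, ∃ j : Fin n, j.castSucc = σ i.castSucc := fun i =>
    Fin.exists_castSucc_eq.2 fun h2 =>
      Fin.castSucc_ne_last i (σ.injective (h2.trans h.symm))
  choose f hf using h1
  have hinj : Function.Injective f := fun i j hij =>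
    Fin.castSucc_injective n (σ.injective (by rw [← hf, ← hf, hij]))
  refine ⟨Equiv.ofBijective f (Finite.injective_iff_bijective.1 hinj), Equiv.ext fun i => ?_⟩
  induction i using Fin.lastCases with
  | last => rw [plus_last, h]
  | cast i => rw [plus_castSucc, ← hf, Equiv.ofBijective_apply]

theorem plus_injective : Function.Injective (plus (n := n)) := fun σ τ h =>
  Equiv.ext fun i => Fin.castSucc_injective n (by rw [← plus_castSucc, ← plus_castSucc, h])

theorem sign_plus (σ : Equiv.Perm (Fin n)) :
    Equiv.Perm.sign (plus σ) = Equiv.Perm.sign σ := by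
  rw [plus, Equiv.Perm.sign_permCongr, Equiv.optionCongr_sign]

theorem setLastZero_polyRep_plus (σ : Equiv.Perm (Fin n))
    (p : MvPolynomial (Fin (n + 1)) ℚ) :
    setLastZero n (polyRep (n + 1) (plus σ) p) = polyRep n σ (setLastZero n p) := by
  have h : (setLastZero n).comp (MvPolynomial.rename (plus σ)) =
      (MvPolynomial.rename σ).comp (setLastZero n) := by
    refine MvPolynomial.algHom_ext fun i => ?_
    induction i using Fin.lastCases with
    | last => simp [setLastZero, plus_last]
    | cast i => simp [setLastZero, plus_castSucc]
  exact DFunLike.congr_fun h p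

theorem coeff_setLastZero (p : MvPolynomial (Fin (n + 1)) ℚ) (e : Fin n →₀ ℕ) :
    MvPolynomial.coeff e (setLastZero n p) =
      MvPolynomial.coeff (e.mapDomain Fin.castSucc) p := by
  classical
  have hcs : ∀ i : Fin n, e.mapDomain Fin.castSucc i.castSucc = e i := fun i =>
    Finsupp.mapDomain_apply (Fin.castSucc_injective n) e i
  have hl : e.mapDomain Fin.castSucc (Fin.last n) = 0 :=
    Finsupp.mapDomain_of_notMem_range _ _ (by simp)
  induction p using MvPolynomial.induction_on' with
  | add p q hp hq => rw [map_add, MvPolynomial.coeff_add, MvPolynomial.coeff_add, hp, hq]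
  | monomial d a =>
    rw [setLastZero, MvPolynomial.aeval_monomial, Finsupp.prod_fintype _ _ (by simp),
      Fin.prod_univ_castSucc, MvPolynomial.coeff_monomial]
    simp only [Fin.lastCases_last, Fin.lastCases_castSucc]
    by_cases h0 : d (Fin.last n) = 0
    · have h1 : ∏ i : Fin n, (MvPolynomial.X i : MvPolynomial (Fin n) ℚ) ^ d i.castSucc =
          MvPolynomial.monomial (Finsupp.equivFunOnFinite.symm fun i => d i.castSucc) 1 := by
        rw [MvPolynomial.monomial_eq, Finsupp.prod_fintype _ _ (by simp)]
        simp
      rw [h0, pow_zero, mul_one, h1, MvPolynomial.algebraMap_eq, MvPolynomial.C_mul_monomial,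
        mul_one, MvPolynomial.coeff_monomial]
      congr 1
      rw [eq_iff_iff]
      constructor
      · rintro rfl
        ext i
        induction i using Fin.lastCases with
        | last => rw [hl, h0]
        | cast i => rw [hcs]; rfl
      · rintro rfl
        ext i
        exact hcs i
    · rw [zero_pow h0, mul_zero, mul_zero, MvPolynomial.coeff_zero, if_neg]
      rintro rfl
      exact h0 hl

theorem mapDomain_plus (σ : Equiv.Perm (Fin n)) (d : Fin n →₀ ℕ) :
    (d.mapDomain Fin.castSucc).mapDomain (plus σ) = (d.mapDomain σ).mapDomain Fin.castSucc := by
  rw [← Finsupp.mapDomain_comp, ← Finsupp.mapDomain_comp]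
  congr 1
  ext i
  simp [plus_castSucc]

end Plus

/-! ### Appending a largest entry to the first row -/

section Append

variable {n : ℕ} {T U : Filling} {r : ℕ}

/-- The exponent vector of `p_T^S`. -/
def exponents (n : ℕ) (T S : Filling) : Fin n →₀ ℕ :=
  Finsupp.equivFunOnFinite.symm fun i => ct n S (box T (i + 1))

theorem monomialOf_eq (n : ℕ) (T S : Filling) :
    monomialOf n T S = MvPolynomial.monomial (exponents n T S) 1 := by
  rw [MvPolynomial.monomial_eq, Finsupp.prod_fintype _ _ (by simp)]
  simp [monomialOf, exponents]

theorem plus_mem_rowGroup (hcs : ∀ i : Fin n, box U (i.castSucc + 1) = box T (i + 1))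
    (σ : Equiv.Perm (Fin n)) : plus σ ∈ rowGroup (n + 1) U ↔ σ ∈ rowGroup n T := by
  change (∀ i, _) ↔ (∀ i, _)
  rw [Fin.forall_fin_succ']
  simp only [plus_castSucc, plus_last, hcs, and_true]

theorem plus_mem_colGroup (hcs : ∀ i : Fin n, box U (i.castSucc + 1) = box T (i + 1))
    (σ : Equiv.Perm (Fin n)) : plus σ ∈ colGroup (n + 1) U ↔ σ ∈ colGroup n T := by
  change (∀ i, _) ↔ (∀ i, _)
  rw [Fin.forall_fin_succ']
  simp only [plus_castSucc, plus_last, hcs, and_true]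

/-- The row group of the larger tableau relates two monomials without the last variable only if
the row group of the smaller one does: if `τ` does not fix the last element, it may be composed
with the transposition of the last element and its image, both of which have exponent `0`. -/
theorem exists_mem_rowGroup_iff
    (hcs : ∀ i : Fin n, box U (i.castSucc + 1) = box T (i + 1)) (d e : Fin n →₀ ℕ) :
    (∃ τ ∈ rowGroup (n + 1) U,
      (d.mapDomain Fin.castSucc).mapDomain τ = e.mapDomain Fin.castSucc) ↔
    ∃ τ ∈ rowGroup n T, d.mapDomain τ = e := by
  have hl : ∀ f : Fin n →₀ ℕ, f.mapDomain Fin.castSucc (Fin.last n) = 0 := fun f =>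
    Finsupp.mapDomain_of_notMem_range _ _ (by simp)
  constructor
  · rintro ⟨τ, hτ, h⟩
    have hrow := hτ (Fin.last n)
    have ha : e.mapDomain Fin.castSucc (τ (Fin.last n)) = 0 := by
      rw [← h, Finsupp.mapDomain_apply τ.injective, hl]
    have hs : (e.mapDomain Fin.castSucc).mapDomain
        (Equiv.swap (τ (Fin.last n)) (Fin.last n)) = e.mapDomain Fin.castSucc := by
      ext i
      rw [Finsupp.mapDomain_equiv_apply, Equiv.symm_swap, Equiv.swap_apply_def]
      split_ifs with h1 h1
      · rw [h1, ha, hl]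
      · rw [h1, ha, hl]
      · rfl
    have hswap : Equiv.swap (τ (Fin.last n)) (Fin.last n) ∈ rowGroup (n + 1) U := by
      intro i
      rw [Equiv.swap_apply_def]
      split_ifs with h1 h1
      · rw [h1, hrow]
      · rw [h1, hrow]
      · rfl
    obtain ⟨ρ, hρ⟩ := exists_plus_eq
      (σ := Equiv.swap (τ (Fin.last n)) (Fin.last n) * τ) (by simp)
    refine ⟨ρ, (plus_mem_rowGroup hcs ρ).1 (hρ ▸ mul_mem hswap hτ),
      Finsupp.mapDomain_injective (Fin.castSucc_injective n) ?_⟩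
    rw [← mapDomain_plus, hρ, Equiv.Perm.coe_mul, Finsupp.mapDomain_comp, h, hs]
  · rintro ⟨τ, hτ, rfl⟩
    exact ⟨plus τ, (plus_mem_rowGroup hcs τ).2 hτ, mapDomain_plus τ d⟩

/-- The last element is alone in its column, so it is fixed by the column group. -/
theorem apply_last_of_mem_colGroup
    (h : ∀ i : Fin n, (box U (i.castSucc + 1)).2 ≠ (box U (n + 1)).2)
    {σ : Equiv.Perm (Fin (n + 1))} (hσ : σ ∈ colGroup (n + 1) U) :
    σ (Fin.last n) = Fin.last n := by
  by_contra h1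
  obtain ⟨i, hi⟩ := Fin.exists_castSucc_eq.2 h1
  have h2 := hσ (Fin.last n)
  rw [← hi] at h2
  exact h i h2

/-- The column groups agree, and the orbit sum over the larger row group becomes the one over the
smaller row group. -/
theorem setLastZero_act (hcs : ∀ i : Fin n, box U (i.castSucc + 1) = box T (i + 1))
    (hlast : ∀ i : Fin n, (box U (i.castSucc + 1)).2 ≠ (box U (n + 1)).2) (d : Fin n →₀ ℕ) :
    setLastZero n ((stabCard (rowGroup (n + 1) U)
        (inclusion n (MvPolynomial.monomial d 1)) : ℚ)⁻¹ •
        act (youngSymmetrizer (n + 1) U) (inclusion n (MvPolynomial.monomial d 1))) =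
      (stabCard (rowGroup n T) (MvPolynomial.monomial d 1) : ℚ)⁻¹ •
        act (youngSymmetrizer n T) (MvPolynomial.monomial d 1) := by
  classical
  have hincl : inclusion n (MvPolynomial.monomial d 1) =
      MvPolynomial.monomial (d.mapDomain Fin.castSucc) 1 := MvPolynomial.rename_monomial _ _ _
  have hrow : setLastZero n ((stabCard (rowGroup (n + 1) U)
        (inclusion n (MvPolynomial.monomial d 1)) : ℚ)⁻¹ •
        ∑ τ : rowGroup (n + 1) U, polyRep (n + 1) τ (inclusion n (MvPolynomial.monomial d 1))) =
      (stabCard (rowGroup n T) (MvPolynomial.monomial d 1) : ℚ)⁻¹ •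
        ∑ τ : rowGroup n T, polyRep n τ (MvPolynomial.monomial d 1) := by
    ext e
    rw [coeff_setLastZero, hincl, coeff_orbitSum, coeff_orbitSum]
    simp only [exists_mem_rowGroup_iff hcs]
  rw [act_youngSymmetrizer, act_youngSymmetrizer, Finset.smul_sum, Finset.smul_sum, map_sum]
  symm
  refine Fintype.sum_bijective
    (fun σ : colGroup n T => (⟨plus σ, (plus_mem_colGroup hcs _).2 σ.2⟩ : colGroup (n + 1) U))
    ⟨fun σ τ h => Subtype.ext (plus_injective (Subtype.ext_iff.1 h)), fun σ => ?_⟩ _ _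
    fun σ => ?_
  · obtain ⟨ρ, hρ⟩ := exists_plus_eq (apply_last_of_mem_colGroup hlast σ.2)
    exact ⟨⟨ρ, (plus_mem_colGroup hcs ρ).1 (hρ ▸ σ.2)⟩, Subtype.ext hρ⟩
  · rw [sign_plus, smul_comm, smul_comm (stabCard (rowGroup (n + 1) U) _ : ℚ)⁻¹, map_smul,
      ← map_smul (polyRep (n + 1) _), setLastZero_polyRep_plus, hrow, map_smul]

/-- The box to which the cyclic rotation of a first row of `r + 1` boxes moves the box `c`; it
undoes `shiftBox`. -/
def rotBox (r : ℕ) : ℕ × ℕ → ℕ × ℕ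
  | (0, 0) => (0, r)
  | (0, j + 1) => (0, j)
  | (i + 1, j) => (i + 1, j)

theorem rotBox_shiftBox (r : ℕ) (c : ℕ × ℕ) : rotBox r (shiftBox c) = c := by
  obtain ⟨_ | i, j⟩ := c <;> rfl

theorem rotBox_fst (r : ℕ) (c : ℕ × ℕ) : (rotBox r c).1 = c.1 := by
  obtain ⟨_ | i, _ | j⟩ := c <;> rfl

theorem apply_rotBox_ne_zero (hrU : ∀ j, U (0, j) ≠ 0 ↔ j < r + 1) {c : ℕ × ℕ} (hc : U c ≠ 0) :
    U (rotBox r c) ≠ 0 := by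
  obtain ⟨_ | i, _ | j⟩ := c
  · exact (hrU r).2 (Nat.lt_succ_self r)
  · exact (hrU j).2 (by have := (hrU _).1 hc; omega)
  · exact hc
  · exact hc

theorem rotBox_inj (hrU : ∀ j, U (0, j) ≠ 0 ↔ j < r + 1) {c d : ℕ × ℕ} (hc : U c ≠ 0)
    (hd : U d ≠ 0) (h : rotBox r c = rotBox r d) : c = d := by
  rcases eq_zero_or_shiftBox c with rfl | ⟨c, rfl⟩ <;>
    rcases eq_zero_or_shiftBox d with rfl | ⟨d, rfl⟩
  · rfl
  · rw [rotBox_shiftBox] at h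
    subst h
    exact absurd ((hrU _).1 hd) (lt_irrefl _)
  · rw [rotBox_shiftBox] at h
    subst h
    exact absurd ((hrU _).1 hc) (lt_irrefl _)
  · rw [rotBox_shiftBox, rotBox_shiftBox] at h
    rw [h]

/-- The row group contains the permutation that rotates the entries of the first row. -/
theorem exists_mem_rowGroup_rotBox (hU : IsTableau U) (hrU : ∀ j, U (0, j) ≠ 0 ↔ j < r + 1)
    (hexU : ∀ v, v ≠ 0 → ((∃ c, U c = v) ↔ v ≤ n)) :
    ∃ τ ∈ rowGroup n U, ∀ i : Fin n, box U (τ i + 1) = rotBox r (box U (i + 1)) := by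
  have hbox : ∀ i : Fin n, U (box U (i + 1)) = i + 1 := fun i =>
    apply_box ((hexU _ (Nat.succ_ne_zero i)).2 i.2)
  have hne : ∀ i : Fin n, U (box U (i + 1)) ≠ 0 := fun i => (hbox i).trans_ne (Nat.succ_ne_zero i)
  have hrot : ∀ i : Fin n, U (rotBox r (box U (i + 1))) ≠ 0 := fun i =>
    apply_rotBox_ne_zero hrU (hne i)
  have hex : ∀ i : Fin n, ∃ k : Fin n, U (rotBox r (box U (i + 1))) = k + 1 := fun i => by
    have h1 := hrot i
    have h2 := (hexU _ h1).1 ⟨_, rfl⟩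
    exact ⟨⟨U (rotBox r (box U (i + 1))) - 1, by omega⟩, by dsimp only; omega⟩
  choose f hf using hex
  have hboxf : ∀ i, box U (f i + 1) = rotBox r (box U (i + 1)) := fun i =>
    hU.box_eq (hf i) (Nat.succ_ne_zero _)
  have hinj : Function.Injective f := fun i j h => by
    have h1 := rotBox_inj hrU (hne i) (hne j) (by rw [← hboxf, ← hboxf, h])
    have h2 := hbox i
    rw [h1, hbox j] at h2
    exact Fin.ext (by omega)
  refine ⟨Equiv.ofBijective f (Finite.injective_iff_bijective.1 hinj), fun i => ?_, hboxf⟩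
  rw [Equiv.ofBijective_apply, hboxf, rotBox_fst]

/-- The cocharge entries of the first row of `shiftRow S` are those of `S` and a `0` in a
different order, so that the monomials agree up to an element of the row group. -/
theorem exists_polyRep_monomialOf_eq {S : Filling} (hU : IsTableau U)
    (hrU : ∀ j, U (0, j) ≠ 0 ↔ j < r + 1) (hexU : ∀ v, v ≠ 0 → ((∃ c, U c = v) ↔ v ≤ n + 1))
    (hcs : ∀ i : Fin n, box U (i.castSucc + 1) = box T (i + 1))
    (hlast : box U (n + 1) = (0, r)) (hSr : S (0, r) = 0) (hS : IsTableau S)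
    (hS' : IsTableau (shiftRow S)) (hex : ∀ v, v ≠ 0 → v ≤ n → ∃ c, S c = v) :
    ∃ τ : rowGroup (n + 1) U,
      polyRep (n + 1) τ (monomialOf (n + 1) U (shiftRow S)) = inclusion n (monomialOf n T S) := by
  obtain ⟨τ, hτ, hbox⟩ := exists_mem_rowGroup_rotBox hU hrU hexU
  refine ⟨⟨τ, hτ⟩, ?_⟩
  have hct : ∀ c, ct (n + 1) (shiftRow S) c = ct n S (rotBox r c) := fun c => by
    rcases eq_zero_or_shiftBox c with rfl | ⟨c, rfl⟩
    · rw [ct_shiftRow_zero hS hS' hex]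
      exact (ct_of_eq_zero hSr).symm
    · rw [ct_shiftRow hS hS' hex, rotBox_shiftBox]
  have hexp : ∀ i : Fin (n + 1),
      (exponents n T S).mapDomain Fin.castSucc i = ct n S (box U (i + 1)) := fun i => by
    induction i using Fin.lastCases with
    | last =>
      rw [Finsupp.mapDomain_of_notMem_range _ _ (by simp), Fin.val_last, hlast,
        ct_of_eq_zero hSr]
    | cast i =>
      rw [Finsupp.mapDomain_apply (Fin.castSucc_injective n), hcs]
      rfl
  rw [monomialOf_eq, monomialOf_eq, polyRep_monomial, inclusion, MvPolynomial.rename_monomial]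
  refine congrArg (fun d => MvPolynomial.monomial d 1) (Finsupp.ext fun i => ?_)
  obtain ⟨i, rfl⟩ := τ.surjective i
  rw [Finsupp.mapDomain_apply τ.injective, hexp, hbox, ← hct]
  rfl

end Append

end HigherSpecht

end

theorem mainTheorem3 (n : ℕ) (w : Equiv.Perm (Fin n)) :
    (HigherSpecht.F (HigherSpecht.plus w) =
      (HigherSpecht.stabSize (n + 1) (HigherSpecht.P (HigherSpecht.plus w))
          (HigherSpecht.Qtilde (HigherSpecht.plus w)) : ℚ)⁻¹ •
        HigherSpecht.act
          (HigherSpecht.youngSymmetrizer (n + 1) (HigherSpecht.P (HigherSpecht.plus w)))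
          (HigherSpecht.monomialOf (n + 1) (HigherSpecht.P (HigherSpecht.plus w))
            (HigherSpecht.Qtilde (HigherSpecht.plus w)))) ∧
    (HigherSpecht.F (HigherSpecht.plus w) =
      (HigherSpecht.stabSize (n + 1) (HigherSpecht.P (HigherSpecht.plus w))
          (HigherSpecht.Qtilde (HigherSpecht.plus w)) : ℚ)⁻¹ •
        HigherSpecht.act
          (HigherSpecht.youngSymmetrizer (n + 1) (HigherSpecht.P (HigherSpecht.plus w)))
          (HigherSpecht.inclusion n
            (HigherSpecht.monomialOf n (HigherSpecht.P w) (HigherSpecht.Qtilde w)))) ∧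
    HigherSpecht.setLastZero n (HigherSpecht.F (HigherSpecht.plus w)) = HigherSpecht.F w := by
  open HigherSpecht in
  obtain ⟨r, hr⟩ := (P_isTableau w).exists_rowLen
  have hP := P_plus w hr
  have hU := P_isTableau (plus w)
  have hr0 : P w (0, r) = 0 := by simpa using hr r
  have happly : ∀ i : Fin n, P w (box (P w) (i + 1)) = i + 1 := fun i =>
    apply_box ((exists_P_eq w (Nat.succ_ne_zero i)).2 i.2)
  have hcs : ∀ i : Fin n, box (P (plus w)) (i.castSucc + 1) = box (P w) (i + 1) := by
    intro i
    refine hU.box_eq ?_ (Nat.succ_ne_zero _)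
    rw [hP, Function.update_of_ne]
    · exact happly i
    · intro h
      have h1 := happly i
      rw [h, hr0] at h1
      omega
  have hlast : box (P (plus w)) (n + 1) = (0, r) := by
    refine hU.box_eq ?_ (Nat.succ_ne_zero _)
    rw [hP, Function.update_self]
  have hrU : ∀ j, P (plus w) (0, j) ≠ 0 ↔ j < r + 1 := by
    intro j
    rw [hP, Function.update_apply]
    split_ifs with h
    · simp_all
    · rw [hr]
      simp only [Prod.mk.injEq, true_and] at h
      omega
  have hcol : ∀ i : Fin n,
      (box (P (plus w)) (i.castSucc + 1)).2 ≠ (box (P (plus w)) (n + 1)).2 := by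
    intro i h
    rw [hcs, hlast] at h
    have h1 := happly i
    generalize box (P w) (i + 1) = c at h h1
    obtain ⟨k, l⟩ := c
    dsimp only at h
    subst h
    rcases Nat.eq_zero_or_pos k with rfl | hk
    · omega
    · exact ((P_isTableau w).col_lt hk (h1.trans_ne (Nat.succ_ne_zero _))).1 hr0
  have hSr : Qtilde w (0, r) = 0 := by
    have := Qtilde_ne_zero_iff w (0, r)
    tauto
  obtain ⟨τ, hτ⟩ := exists_polyRep_monomialOf_eq (T := P w) hU hrU
    (fun v hv => exists_P_eq (plus w) hv) hcs hlast hSr (Qtilde_isTableau w)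
    (Qtilde_plus w ▸ Qtilde_isTableau (plus w)) fun v hv hv' => exists_Qtilde_eq w hv hv'
  rw [← Qtilde_plus] at hτ
  have h2 : F (plus w) = (stabSize (n + 1) (P (plus w)) (Qtilde (plus w)) : ℚ)⁻¹ •
      act (youngSymmetrizer (n + 1) (P (plus w)))
        (inclusion n (monomialOf n (P w) (Qtilde w))) := by
    rw [← hτ, act_youngSymmetrizer_polyRep]
    rfl
  refine ⟨rfl, h2, ?_⟩
  have h3 : stabSize (n + 1) (P (plus w)) (Qtilde (plus w)) =
      stabCard (rowGroup (n + 1) (P (plus w))) (inclusion n (monomialOf n (P w) (Qtilde w))) := by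
    rw [← hτ, stabCard_polyRep]
    rfl
  rw [h2, h3, F, higherSpecht, monomialOf_eq, setLastZero_act hcs hcol]
  rw [← monomialOf_eq]
  rfl
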